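/- **Setting.** Let $A_\star\in\mathbb R^{n\times n}$, $B_\star\in\mathbb R^{n\times m}$, $C_\star\in\mathbb R^{p\times n}$ with spectral radius $\rho(A_\star)<1$, and let $\mathbf G_\star(z)=C_\star(zI-A_\star)^{-1}B_\star$. Consider the closed loop $x_{t+1}=A_\star x_t+B_\star u_t$, $y_t=C_\star x_t+v_t$, with $u_t$ the sum of the output of a controller and $w_t$. Here $w_t\sim\mathcal N(0,I_m)$, $v_t\sim\mathcal N(0,I_p)$ are independent and the initial states are zero. The controller $\mathbf K$ is linear time-invariant with a state-space realization $\mathbf K(z)=C_k(zI-A_k)^{-1}B_k+D_k$. It *internally stabilizes* $\mathbf G_\star$ if, for some realization, $$\rho\begin{bmatrix}A_\star+B_\star D_kC_\star & B_\star C_k\\ B_kC_\star & A_k\end{bmatrix}<1 .$$ The LQG cost is $\lim_{T\to\infty}\mathbb E\big[\frac1T\sum_{t=0}^T(y_t^{\mathsf T}y_t+u_t^{\mathsf T}u_t)\big]$. Let $\mathbf K_\star$ be an optimal LQG controller, i.e. one that minimizes this cost over all internally stabilizing controllers. $\mathcal{RH}_\infty$ denotes the real-rational, proper transfer matrices with all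 poles in $|z|<1$. Write $\|\mathbf G\|_\infty=\sup_\omega\sigma_{\max}(\mathbf G(e^{j\omega}))$ and $\|\mathbf G\|_{\mathcal H_2}^2=\frac1{2\pi}\int_{-\pi}^{\pi}\operatorname{Trace}\big(\mathbf G(e^{j\omega})^*\mathbf G(e^{j\omega})\big)d\omega$. For a controller $\mathbf K$ that internally stabilizes $\mathbf G_\star$ let $$\begin{bmatrix}\mathbf Y&\mathbf W\\ \mathbf U&\mathbf Z\end{bmatrix}=\begin{bmatrix}(I-\mathbf G_\star\mathbf K)^{-1}&(I-\mathbf G_\star\mathbf K)^{-1}\mathbf G_\star\\ \mathbf K(I-\mathbf G_\star\mathbf K)^{-1}&(I-\mathbf K\mathbf G_\star)^{-1}\end{bmatrix},\qquad J(\mathbf G_\star,\mathbf K)=\left\|\begin{bmatrix}\mathbf Y&\mathbf W\\ \mathbf U&\mathbf Z\end{bmatrix}\right\|_{\mathcal H_2},$$ the square root of the LQG cost. Let $\mathbf Y_\star,\mathbf U_\star,\mathbf W_\star,\mathbf Z_\star$ be the responses for $\mathbf K=\mathbf K_\star$. Let $\hat{\mathbf G}\in\mathcal{RH}_\infty$ be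 an estimate of $\mathbf G_\star$ with $\|\mathbf G_\star-\hat{\mathbf G}\|_\infty<\epsilon$. Assume $\epsilon<\frac1{5\|\mathbf U_\star\|_\infty}$ (no restriction if $\mathbf U_\star=0$) and $\alpha\in\Big[\frac{\sqrt2\,\|\mathbf U_\star\|_\infty}{1-\epsilon\|\mathbf U_\star\|_\infty},\frac1\epsilon\Big)$. Put $$h(\epsilon,\alpha)=\epsilon\|\hat{\mathbf G}\|_\infty(2+\alpha\|\hat{\mathbf G}\|_\infty)+\epsilon^2(2+\alpha\|\hat{\mathbf G}\|_\infty)^2,$$ $$g(\epsilon,\|\mathbf U_\star\|_\infty)=\epsilon\|\mathbf G_\star\|_\infty(2+\|\mathbf U_\star\|_\infty\|\mathbf G_\star\|_\infty)+\epsilon^2(2+\|\mathbf U_\star\|_\infty\|\mathbf G_\star\|_\infty)^2 .$$ Consider the problem $$\min_{\gamma\in[0,1/\epsilon)}\ \frac1{1-\epsilon\gamma}\ \min_{\hat{\mathbf Y},\hat{\mathbf W},\hat{\mathbf U},\hat{\mathbf Z}\in\mathcal{RH}_\infty}\left\|\begin{bmatrix}\sqrt{1+h(\epsilon,\alpha)}\,\hat{\mathbf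 Y}&\hat{\mathbf W}\\ \hat{\mathbf U}&\hat{\mathbf Z}\end{bmatrix}\right\|_{\mathcal H_2}\tag{P}$$ subject to $\|\hat{\mathbf U}\|_\infty\le\min(\gamma,\alpha)$ and $$\begin{bmatrix}I&-\hat{\mathbf G}\end{bmatrix}\begin{bmatrix}\hat{\mathbf Y}&\hat{\mathbf W}\\ \hat{\mathbf U}&\hat{\mathbf Z}\end{bmatrix}=\begin{bmatrix}I&0\end{bmatrix},\qquad \begin{bmatrix}\hat{\mathbf Y}&\hat{\mathbf W}\\ \hat{\mathbf U}&\hat{\mathbf Z}\end{bmatrix}\begin{bmatrix}-\hat{\mathbf G}\\ I\end{bmatrix}=\begin{bmatrix}0\\ I\end{bmatrix}.$$ **Theorem.** 1. Let $\gamma_\star,\hat{\mathbf Y}_\star,\hat{\mathbf U}_\star,\hat{\mathbf W}_\star,\hat{\mathbf Z}_\star$ be an optimal solution of (P). Then $\hat{\mathbf Y}_\star$ is invertible, the controller $\mathbf K=\hat{\mathbf U}_\star\hat{\mathbf Y}_\star^{-1}$ internally stabilizes the true plant $\mathbf G_\star$, and $$\frac{J(\mathbf G_\star,\mathbf K)^2-J(\mathbf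 G_\star,\mathbf K_\star)^2}{J(\mathbf G_\star,\mathbf K_\star)^2}\le 20\,\epsilon\,\|\mathbf U_\star\|_\infty+h(\epsilon,\alpha)+g(\epsilon,\|\mathbf U_\star\|_\infty).$$ 2. In particular the relative error is $O(\epsilon)$: for all bounds $\bar\epsilon,\bar\alpha$ there is a constant $M$, depending only on the plant, $\mathbf K_\star$, $\bar\epsilon$ and $\bar\alpha$, such that the left-hand side is at most $M\epsilon$ whenever in addition $\epsilon\le\bar\epsilon$ and $\alpha\le\bar\alpha$. 3. If the minimum in (P) is only reached up to a factor, i.e. $(\gamma,\hat{\mathbf Y},\hat{\mathbf U},\hat{\mathbf W},\hat{\mathbf Z})$ is feasible and its objective is at most $(1+\delta)$ times that of every feasible point, with $\delta\ge0$, then $\hat{\mathbf Y}$ is invertible, $\mathbf K=\hat{\mathbf U}\hat{\mathbf Y}^{-1}$ internally stabilizes $\mathbf G_\star$, and $$1+\frac{J(\mathbf G_\star,\mathbf K)^2-J(\mathbf G_\star,\mathbf K_\star)^2}{J(\mathbf G_\star,\mathbf K_\star)^2}\le(1+\delta)^2\big(1+20\,\epsilon\,\|\mathbf U_\star\|_\infty+h(\epsilon,\alpha)+g(\epsilon,\|\mathbf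 U_\star\|_\infty)\big).$$ -/

import Mathlib

open Matrix MeasureTheory ProbabilityTheory Filter Topology

noncomputable section

namespace LQG

/-! ### Transfer matrices -/

/-- Real-rational transfer matrices in the variable `z`, with rows `ι` and columns `κ`. -/
abbrev TransferMatrix (ι κ : Type) : Type := Matrix ι κ (RatFunc ℝ)

/-- The value `G(e^{jω})` of a transfer matrix on the unit circle. -/
def freqResponse {ι κ : Type} (G : TransferMatrix ι κ) (ω : ℝ) : Matrix ι κ ℂ :=
  G.map fun f => RatFunc.eval (algebraMap ℝ ℂ) (Complex.exp (ω * Complex.I)) f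

/-- A scalar rational function is proper and has all its poles in the open unit disc. -/
def IsProperStable (f : RatFunc ℝ) : Prop :=
  f.num.natDegree ≤ f.denom.natDegree ∧
    ∀ z : ℂ, 1 ≤ ‖z‖ → Polynomial.aeval z f.denom ≠ 0

/-- Membership in `RH_∞`: all entries are real-rational, proper and stable. -/
def InRHinf {ι κ : Type} (G : TransferMatrix ι κ) : Prop :=
  ∀ i j, IsProperStable (G i j)

/-- The largest singular value of a complex matrix, i.e. its operator norm with respect to the
Euclidean norms. -/
def sigmaMax {ι κ : Type} [Fintype ι] [Fintype κ] [DecidableEq κ] (M : Matrix ι κ ℂ) : ℝ :=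
  ‖LinearMap.toContinuousLinearMap (Matrix.toEuclideanLin M)‖

/-- The `H_∞` norm `sup_ω σ_max (G(e^{jω}))` of a stable transfer matrix. -/
def hinfNorm {ι κ : Type} [Fintype ι] [Fintype κ] [DecidableEq κ]
    (G : TransferMatrix ι κ) : ℝ :=
  ⨆ ω : ℝ, sigmaMax (freqResponse G ω)

/-- The `H_2` norm `((1/2π) ∫_{-π}^{π} Trace (G(e^{jω})ᴴ G(e^{jω})) dω)^{1/2}` of a stable transfer
matrix; the trace is written as the sum of the squared moduli of the entries. -/
def h2Norm {ι κ : Type} [Fintype ι] [Fintype κ] (G : TransferMatrix ι κ) : ℝ :=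
  √((1 / (2 * Real.pi)) *
    ∫ ω in (-Real.pi)..Real.pi, ∑ i, ∑ j, ‖freqResponse G ω i j‖ ^ 2)

/-! ### State-space systems and controllers -/

/-- A real matrix regarded as a constant transfer matrix. -/
def constTM {ι κ : Type} (M : Matrix ι κ ℝ) : TransferMatrix ι κ :=
  M.map fun r => RatFunc.C r

/-- The transfer matrix `C (zI - A)⁻¹ B + D`. -/
def transferMatrix {n m p : ℕ} (A : Matrix (Fin n) (Fin n) ℝ) (B : Matrix (Fin n) (Fin m) ℝ)
    (C : Matrix (Fin p) (Fin n) ℝ) (D : Matrix (Fin p) (Fin m) ℝ) :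
    TransferMatrix (Fin p) (Fin m) :=
  constTM C * (Matrix.scalar (Fin n) (RatFunc.X : RatFunc ℝ) - constTM A)⁻¹ * constTM B + constTM D

/-- The spectral radius of a real square matrix is less than one (all complex eigenvalues lie in the
open unit disc). -/
def SchurStable {ι : Type} [Fintype ι] [DecidableEq ι] (M : Matrix ι ι ℝ) : Prop :=
  spectralRadius ℂ (M.map Complex.ofReal) < 1

/-- A linear output-feedback controller `ξ_{t+1} = A_k ξ_t + B_k y_t`, `u_t = C_k ξ_t + D_k y_t`
with `q`-dimensional state. -/
structure Controller (q m p : ℕ) where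
  Ak : Matrix (Fin q) (Fin q) ℝ
  Bk : Matrix (Fin q) (Fin p) ℝ
  Ck : Matrix (Fin m) (Fin q) ℝ
  Dk : Matrix (Fin m) (Fin p) ℝ

/-- The transfer matrix of a controller. -/
def Controller.tf {q m p : ℕ} (κ : Controller q m p) : TransferMatrix (Fin m) (Fin p) :=
  transferMatrix κ.Ak κ.Bk κ.Ck κ.Dk

section Plant

variable {n m p : ℕ} (A : Matrix (Fin n) (Fin n) ℝ) (B : Matrix (Fin n) (Fin m) ℝ)
  (C : Matrix (Fin p) (Fin n) ℝ)

/-- The state matrix of the interconnection of the plant `(A, B, C)` with a controller. -/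
def closedLoopMatrix {q : ℕ} (κ : Controller q m p) : Matrix (Fin n ⊕ Fin q) (Fin n ⊕ Fin q) ℝ :=
  Matrix.fromBlocks (A + B * κ.Dk * C) (B * κ.Ck) (κ.Bk * C) κ.Ak

/-- The transfer matrix `K` internally stabilizes the plant `(A, B, C)`: some realization of `K`
makes the closed-loop state matrix Schur stable. -/
def InternallyStabilizes (K : TransferMatrix (Fin m) (Fin p)) : Prop :=
  ∃ (q : ℕ) (κ : Controller q m p), κ.tf = K ∧ SchurStable (closedLoopMatrix A B C κ)

/-! ### The LQG problem in the time domain -/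

/-- A sample of the noise: the coordinate `(t, inl i)` is the `i`-th entry of `w_t`, the coordinate
`(t, inr i)` is the `i`-th entry of `v_t`. -/
abbrev NoisePath (m p : ℕ) : Type := ℕ × (Fin m ⊕ Fin p) → ℝ

/-- The law of the noise: `w_t ∼ N(0, I_m)` and `v_t ∼ N(0, I_p)`, all independent. -/
def noiseLaw (m p : ℕ) : Measure (NoisePath m p) :=
  Measure.infinitePi fun _ => gaussianReal 0 1

/-- The output `y = C x + v_t` at time `t`, given the plant state `x`. -/
def outputAt (noise : NoisePath m p) (t : ℕ) (x : Fin n → ℝ) : Fin p → ℝ :=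
  C *ᵥ x + fun i => noise (t, Sum.inr i)

/-- The input `u = C_k ξ + D_k y + w_t` at time `t`, given the controller state and the output. -/
def inputAt {q : ℕ} (κ : Controller q m p) (noise : NoisePath m p) (t : ℕ)
    (ξ : Fin q → ℝ) (y : Fin p → ℝ) : Fin m → ℝ :=
  κ.Ck *ᵥ ξ + κ.Dk *ᵥ y + fun i => noise (t, Sum.inl i)

/-- The pair `(x_t, ξ_t)` of plant and controller states, started at zero. -/
def stateAt {q : ℕ} (κ : Controller q m p) (noise : NoisePath m p) :
    ℕ → (Fin n → ℝ) × (Fin q → ℝ)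
  | 0 => (0, 0)
  | t + 1 =>
    let x := (stateAt κ noise t).1
    let ξ := (stateAt κ noise t).2
    let y := outputAt C noise t x
    let u := inputAt κ noise t ξ y
    (A *ᵥ x + B *ᵥ u, κ.Ak *ᵥ ξ + κ.Bk *ᵥ y)

/-- The stage cost `y_tᵀ y_t + u_tᵀ u_t` along the closed loop. -/
def stageCost {q : ℕ} (κ : Controller q m p) (noise : NoisePath m p) (t : ℕ) : ℝ :=
  let s := stateAt A B C κ noise t
  let y := outputAt C noise t s.1
  let u := inputAt κ noise t s.2 y
  y ⬝ᵥ y + u ⬝ᵥ u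

/-- `c = lim_{T → ∞} E [(1/T) ∑_{t=0}^{T} (y_tᵀ y_t + u_tᵀ u_t)]`. -/
def HasLQGCost {q : ℕ} (κ : Controller q m p) (c : ℝ) : Prop :=
  Tendsto (fun T : ℕ => ∫ noise, (1 / (T : ℝ)) *
    ∑ t ∈ Finset.range (T + 1), stageCost A B C κ noise t ∂(noiseLaw m p)) atTop (𝓝 c)

/-- `K` is an optimal LQG controller: it is the transfer matrix of an internally stabilizing
controller whose LQG cost is at most that of every internally stabilizing controller. -/
def IsOptimalLQG (K : TransferMatrix (Fin m) (Fin p)) : Prop :=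
  ∃ (q : ℕ) (κ : Controller q m p) (c : ℝ),
    κ.tf = K ∧ SchurStable (closedLoopMatrix A B C κ) ∧ HasLQGCost A B C κ c ∧
    ∀ (q' : ℕ) (κ' : Controller q' m p) (c' : ℝ),
      SchurStable (closedLoopMatrix A B C κ') → HasLQGCost A B C κ' c' → c ≤ c'

end Plant

/-! ### Closed-loop responses -/

/-- A quadruple of transfer matrices, arranged in blocks as `[Y W; U Z]`. -/
structure Responses (m p : ℕ) where
  Y : TransferMatrix (Fin p) (Fin p)
  U : TransferMatrix (Fin m) (Fin p)
  W : TransferMatrix (Fin p) (Fin m)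
  Z : TransferMatrix (Fin m) (Fin m)

variable {m p : ℕ}

/-- The block matrix `[Y W; U Z]`. -/
def Responses.block (Φ : Responses m p) :
    TransferMatrix (Fin p ⊕ Fin m) (Fin p ⊕ Fin m) :=
  Matrix.fromBlocks Φ.Y Φ.W Φ.U Φ.Z

/-- The closed-loop responses from `(v, w)` to `(y, u)` of the plant `G` with the controller `K`. -/
def closedLoop (G : TransferMatrix (Fin p) (Fin m)) (K : TransferMatrix (Fin m) (Fin p)) :
    Responses m p where
  Y := (1 - G * K)⁻¹
  U := K * (1 - G * K)⁻¹
  W := (1 - G * K)⁻¹ * G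
  Z := (1 - K * G)⁻¹

/-- The square root `J(G, K)` of the LQG cost, as the `H_2` norm of the closed-loop responses. -/
def lqgJ (G : TransferMatrix (Fin p) (Fin m)) (K : TransferMatrix (Fin m) (Fin p)) : ℝ :=
  h2Norm (closedLoop G K).block

/-- The relative error `(J(G, K)² - J(G, K₀)²) / J(G, K₀)²`. -/
def relativeError (G : TransferMatrix (Fin p) (Fin m))
    (K K₀ : TransferMatrix (Fin m) (Fin p)) : ℝ :=
  (lqgJ G K ^ 2 - lqgJ G K₀ ^ 2) / lqgJ G K₀ ^ 2

/-! ### The robust synthesis problem -/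

/-- `ε Γ (2 + a Γ) + ε² (2 + a Γ)²`. With `Γ = ‖Ĝ‖_∞` this is `h(ε, a)`, and with `Γ = ‖G⋆‖_∞` it is
`g(ε, a)`. -/
def perturbationFactor (Γ ε a : ℝ) : ℝ :=
  ε * Γ * (2 + a * Γ) + ε ^ 2 * (2 + a * Γ) ^ 2

/-- Feasibility of `(γ, Y, U, W, Z)` in the quasi-convex problem for the estimated plant `Ghat`. -/
structure IsFeasible (Ghat : TransferMatrix (Fin p) (Fin m)) (ε α γ : ℝ)
    (Φ : Responses m p) : Prop where
  gamma_nonneg : 0 ≤ γ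
  gamma_lt : γ < 1 / ε
  affine_left :
    (Matrix.fromCols 1 (-Ghat) : TransferMatrix (Fin p) (Fin p ⊕ Fin m)) * Φ.block =
      Matrix.fromCols 1 0
  affine_right :
    Φ.block * (Matrix.fromRows (-Ghat) 1 : TransferMatrix (Fin p ⊕ Fin m) (Fin m)) =
      Matrix.fromRows 0 1
  stable_Y : InRHinf Φ.Y
  stable_U : InRHinf Φ.U
  stable_W : InRHinf Φ.W
  stable_Z : InRHinf Φ.Z
  norm_U_le : hinfNorm Φ.U ≤ min γ α

/-- The objective `(1 - εγ)⁻¹ ‖[√(1 + h(ε, α)) Y, W; U, Z]‖_{H_2}`. -/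
def objective (Ghat : TransferMatrix (Fin p) (Fin m)) (ε α γ : ℝ) (Φ : Responses m p) : ℝ :=
  1 / (1 - ε * γ) *
    h2Norm (Matrix.fromBlocks
      ((RatFunc.C √(1 + perturbationFactor (hinfNorm Ghat) ε α) : RatFunc ℝ) • Φ.Y) Φ.W Φ.U Φ.Z)

/-- `(γ, Y, U, W, Z)` is feasible and its objective is at most `1 + δ` times that of every feasible
point. For `δ = 0` this says that it is an optimal solution. -/
def IsNearOptimal (δ : ℝ) (Ghat : TransferMatrix (Fin p) (Fin m)) (ε α γ : ℝ)
    (Φ : Responses m p) : Prop :=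
  IsFeasible Ghat ε α γ Φ ∧
    ∀ (γ' : ℝ) (Φ' : Responses m p), IsFeasible Ghat ε α γ' Φ' →
      objective Ghat ε α γ Φ ≤ (1 + δ) * objective Ghat ε α γ' Φ'

/-- `(γ, Y, U, W, Z)` is an optimal solution of the quasi-convex problem. -/
def IsOptimalSolution (Ghat : TransferMatrix (Fin p) (Fin m)) (ε α γ : ℝ)
    (Φ : Responses m p) : Prop :=
  IsFeasible Ghat ε α γ Φ ∧
    ∀ (γ' : ℝ) (Φ' : Responses m p), IsFeasible Ghat ε α γ' Φ' →
      objective Ghat ε α γ Φ ≤ objective Ghat ε α γ' Φ'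

/-- The controller `K = U Y⁻¹`. -/
def Responses.controller (Φ : Responses m p) : TransferMatrix (Fin m) (Fin p) :=
  Φ.U * Φ.Y⁻¹

/-- The conditions on the estimate `Ghat` of the plant `G`, the error bound `ε` and the
hyper-parameter `α`, where `u` is the number `‖U⋆‖_∞`. The condition `ε < 1 / (5 u)` is written
without division, so that it holds for every `ε` if `u = 0`. -/
structure IsAdmissible (G Ghat : TransferMatrix (Fin p) (Fin m)) (u ε α : ℝ) : Prop where
  stable : InRHinf Ghat
  error_lt : hinfNorm (G - Ghat) < ε
  small : ε * (5 * u) < 1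
  alpha_ge : √2 * u / (1 - ε * u) ≤ α
  alpha_lt : α < 1 / ε

end LQG

end

/-! Since the plant is stable, everything can be expressed through the Youla parameter `U = K (1 - G
K)⁻¹`. Stabilizing controllers correspond to stable `U` (`exists_stable_response`,
`internallyStabilizes_of_youla`), and the four responses are `1 + G U`, `(1 + G U) G`, `U`, `1 + U
G`. The affine constraints of the synthesis problem say exactly that a feasible point has this form
for the estimated plant (`IsFeasible.eq_youla`).

Upper bound for the synthesized controller (`IsFeasible.robust`). With `D = G - Ghat`, passing from
`Ghat` to `G` turns `U` into `Q = U (1 - D U)⁻¹`. This is stable by the small gain theorem, because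
`‖D U‖ ≤ ε γ < 1` on the circle and hence, by the maximum modulus principle, on the whole exterior
of the disc. Frequency by frequency the true responses exceed the estimated ones by at most the
factor `1 / (1 - ε γ)`, except that `W` also picks up a multiple of `Y`. The weight `√(1 + h)` on
`Y` pays for that (`scalar_plant_response`), so the true cost is at most the squared objective.

Upper bound for the optimal value (`exists_isFeasible_le`). Two feasible points are compared with
`J⋆²`. The first takes `U⋆` with `γ = ‖U⋆‖`; its `W` response contains the error `D U⋆ Ghat`, of
mean square up to `(ε ‖U⋆‖)² ‖Ghat‖² m`, which `J⋆` alone does not control with the required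
constants. The second takes `U = 0`, with squared objective at most `(1 + h) p + m + ‖Ghat‖² m`. If
the second exceeds the target, then `‖1 + G U⋆‖²` is at most an explicit multiple of `m`, and this
makes the first one good enough (`two_candidates`). This step needs `‖1 + G U⋆‖² ≥ p` and `‖1 + U⋆
G‖² ≥ m`, which follow from the mean value property because `G` vanishes at infinity
(`card_le_h2Sq`).

Chaining the two bounds through (near-)optimality gives claims 1 and 3. Claim 2 follows because `h`
and `g` are `ε` times quantities bounded on bounded sets of parameters. -/

noncomputable section

namespace LQG

/-! ### Scalar inequalities -/

/-- This is `S g - D (γ² - h - g) ≥ 0` from `two_candidates`, expanded with `q = γ²`. Completing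
squares in `h` and in `f` leaves only monomials whose coefficients are nonnegative for `x ≤ 1/5`. -/
lemma scaled_quartic_nonneg {x q f g h : ℝ} (hx0 : 0 ≤ x) (hx : x ≤ 1 / 5) (hq : 0 ≤ q)
    (hf : 0 ≤ f) (hh : 0 ≤ h) (hg : f * (1 + x - x ^ 2) + (x + x ^ 2) * q ≤ g) :
    0 ≤ 3 * x * h ^ 2 - h * (3 * x * q - (2 * x - x ^ 2) * g - f)
      + g * (((1 - x) ^ 2 - (x / 10 + 2 * x ^ 2)) * q + f) - f * q := by
  -- The expression is nondecreasing in `g`, so `g` may be replaced by its lower bound `g₀`.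
  set g₀ := f * (1 + x - x ^ 2) + (x + x ^ 2) * q with hg₀
  have hk : 0 ≤ (1 - x) ^ 2 - (x / 10 + 2 * x ^ 2) := by nlinarith
  have hx2 : 0 ≤ 2 * x - x ^ 2 := by nlinarith
  have h1 : g₀ * (((1 - x) ^ 2 - (x / 10 + 2 * x ^ 2)) * q + f) ≤
      g * (((1 - x) ^ 2 - (x / 10 + 2 * x ^ 2)) * q + f) :=
    mul_le_mul_of_nonneg_right hg (by positivity)
  have h2 : h * ((2 * x - x ^ 2) * g₀) ≤ h * ((2 * x - x ^ 2) * g) := by gcongr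
  suffices H : 0 ≤ 3 * x * h ^ 2 - h * (3 * x * q - (2 * x - x ^ 2) * g₀ - f)
      + g₀ * (((1 - x) ^ 2 - (x / 10 + 2 * x ^ 2)) * q + f) - f * q by nlinarith
  have hq2 : 0 ≤ (x * ((1 + x) * ((1 - x) ^ 2 - (x / 10 + 2 * x ^ 2)) - 3 * (1 / 2 - x / 3) ^ 2)
      - (x / 10 + 31 / 10 * x ^ 2) ^ 2 / 4) * q ^ 2 := by
    refine mul_nonneg ?_ (sq_nonneg q)
    have e : x * ((1 + x) * ((1 - x) ^ 2 - (x / 10 + 2 * x ^ 2)) - 3 * (1 / 2 - x / 3) ^ 2)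
      - (x / 10 + 31 / 10 * x ^ 2) ^ 2 / 4 =
      x * (1 / 4 - x * (41 / 400 + 2153 / 600 * x + (1 + 961 / 400) * x ^ 2)) := by
      ring
    rw [e]
    refine mul_nonneg hx0 (sub_nonneg.2 ?_)
    calc x * (41 / 400 + 2153 / 600 * x + (1 + 961 / 400) * x ^ 2)
        ≤ 1 / 5 * (41 / 400 + 2153 / 600 * (1 / 5) + (1 + 961 / 400) * (1 / 5) ^ 2) := by
          gcongr
      _ ≤ 1 / 4 := by norm_num
  have hfh : 0 ≤ h * f * ((2 * x - x ^ 2) * (1 + x - x ^ 2) + 1) := by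
    have : 0 ≤ 1 + x - x ^ 2 := by nlinarith
    positivity
  have hhq : 0 ≤ h * q * ((2 * x - x ^ 2) * (x + x ^ 2) - 2 * x ^ 2) := by
    have : 0 ≤ (2 * x - x ^ 2) * (x + x ^ 2) - 2 * x ^ 2 := by nlinarith [pow_nonneg hx0 3]
    positivity
  -- `x/10 + 31/10 x²` is chosen to cancel the terms in `x` and `x²` of the coefficient of `f q`;
  -- what remains is `11/10 x³ + x⁴`.
  have hfq : 0 ≤ f * q * ((1 + x - x ^ 2) * ((1 - x) ^ 2 - (x / 10 + 2 * x ^ 2)) + x + x ^ 2 - 1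
      + (x / 10 + 31 / 10 * x ^ 2)) := by
    have : 0 ≤ (1 + x - x ^ 2) * ((1 - x) ^ 2 - (x / 10 + 2 * x ^ 2)) + x + x ^ 2 - 1
      + (x / 10 + 31 / 10 * x ^ 2) := by nlinarith [pow_nonneg hx0 3, pow_nonneg hx0 4]
    positivity
  have hff : 0 ≤ (x - x ^ 2) * f ^ 2 := by
    have : 0 ≤ x - x ^ 2 := by nlinarith
    positivity
  -- The centre `(1/2 - x/3) q` cancels the `h q` coefficient through order `x²`; the remainder `x³
  -- - x⁴` is `hhq`.
  have s1 : 0 ≤ 3 * x * (h - (1 / 2 - x / 3) * q) ^ 2 := by positivity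
  have s2 : 0 ≤ (f - (x / 10 + 31 / 10 * x ^ 2) / 2 * q) ^ 2 := sq_nonneg _
  rw [hg₀]
  linarith

/-- One of two upper bounds for the optimal value is below the target: `y`, `w`, `s`, `z` are the
squared norms of the responses, `Γ` and `γ` the gains of the plant and of its estimate. -/
lemma two_candidates {x ε Γ γ h g p m y w s z : ℝ} (hx0 : 0 ≤ x) (hx : x ≤ 1 / 5) (hε : 0 ≤ ε)
    (hΓ : 0 ≤ Γ) (hγ : 0 ≤ γ) (hγΓ : γ ≤ Γ + ε) (hh : 0 ≤ h)
    (hg : g = 2 * ε * Γ + x * Γ ^ 2 + (2 * ε + x * Γ) ^ 2) (hp : 0 ≤ p) (hm : 0 ≤ m)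
    (hpy : p ≤ y) (hmz : m ≤ z) (hw : 0 ≤ w) (hs : 0 ≤ s) :
    (1 + h) * p + m + γ ^ 2 * m ≤ (1 + 20 * x + h + g) * (y + w + s + z) ∨
    (1 + h) * ((1 + x) * (y + x * m)) + ((1 + 10 * x) * w + (2 * ε * Γ + 2 * ε ^ 2) * y
        + (x / 10 + 2 * x ^ 2) * (γ ^ 2 * m)) + s + (1 + x) * (z + x * m) ≤
      (1 - x) ^ 2 * ((1 + 20 * x + h + g) * (y + w + s + z)) := by
  have hx1 : 0 ≤ 1 + x - x ^ 2 := by clear * - hx0 hx; nlinarith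
  have hx2 : 0 ≤ 2 - 3 * x + x ^ 2 := by clear * - hx0 hx; nlinarith
  have hg0 : 0 ≤ g := by rw [hg]; positivity
  by_cases hII : (1 + h) * p + m + γ ^ 2 * m ≤ (1 + 20 * x + h + g) * (y + w + s + z)
  · exact Or.inl hII
  right
  push Not at hII
  have hy : 0 ≤ y := hp.trans hpy
  have hz : 0 ≤ z := hm.trans hmz
  -- Failure of the first alternative, with `p`, `z` replaced by `y`, `m` and the terms in `x`, `w`,
  -- `s` dropped: it bounds `y` above by a multiple of `m`.
  have hT : g * y + (h + g) * m < γ ^ 2 * m := by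
    have e1 : 0 ≤ (1 + h) * (y - p) := mul_nonneg (by linarith) (by linarith)
    have e2 : 0 ≤ (1 + 20 * x + h + g) * (z - m) := mul_nonneg (by linarith) (by linarith)
    have e3 : 0 ≤ (1 + 20 * x + h + g) * (w + s) := by positivity
    have e4 : 0 ≤ x * (y + m) := by positivity
    linarith
  have hqH : 0 < γ ^ 2 - h - g := by
    by_contra hc
    push Not at hc
    have := mul_nonneg (sub_nonneg.2 hc) hm
    linarith [mul_nonneg hg0 hy]
  set f := 2 * ε * Γ + 2 * ε ^ 2 with hf
  have hf0 : 0 ≤ f := by positivity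
  -- The coefficients of `ε Γ` agree exactly on both sides once `γ ≤ Γ + ε` is used; only multiples
  -- of `ε²` are given away.
  have hgf : f * (1 + x - x ^ 2) + (x + x ^ 2) * γ ^ 2 ≤ g := by
    have e1 : γ ^ 2 ≤ (Γ + ε) ^ 2 := by gcongr
    have e2 : (x + x ^ 2) * γ ^ 2 ≤ (x + x ^ 2) * (Γ + ε) ^ 2 := by gcongr
    have e3 : 0 ≤ ε * Γ * x := by positivity
    have e4 : 0 ≤ ε ^ 2 * (2 - 3 * x + x ^ 2) := mul_nonneg (sq_nonneg _) hx2
    rw [hg, hf]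
    linarith
  have hE := scaled_quartic_nonneg hx0 hx (sq_nonneg γ) hf0 hh hgf
  -- After the harmless terms are discarded, the second alternative reduces to `D y ≤ S m`: `D` is
  -- the deficit in front of `y`, `S` the surplus left by `z ≥ m`.
  set D := 3 * x * h + f - (1 - x) ^ 2 * g with hD
  set S := (1 - 3 * x) * h + (1 - x) ^ 2 * g - (x / 10 + 2 * x ^ 2) * γ ^ 2 with hS
  have hDS : D * (γ ^ 2 - h - g) ≤ S * g := by
    rw [hD, hS]; linarith
  have hS0 : 0 ≤ S := by
    have e1 : (1 - x) ^ 2 * ((x + x ^ 2) * γ ^ 2) ≤ (1 - x) ^ 2 * g := by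
      refine mul_le_mul_of_nonneg_left ?_ (sq_nonneg _)
      have : 0 ≤ f * (1 + x - x ^ 2) := mul_nonneg hf0 hx1
      linarith
    have e2 : 0 ≤ ((1 - x) ^ 2 * (x + x ^ 2) - (x / 10 + 2 * x ^ 2)) * γ ^ 2 := by
      refine mul_nonneg ?_ (sq_nonneg _)
      have : (1 - x) ^ 2 * (x + x ^ 2) - (x / 10 + 2 * x ^ 2) =
        x * (9 / 10 - 3 * x - x ^ 2 + x ^ 3) := by ring
      rw [this]
      refine mul_nonneg hx0 ?_
      clear * - hx0 hx
      nlinarith [pow_nonneg hx0 3]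
    have e3 : 0 ≤ (1 - 3 * x) * h := mul_nonneg (by linarith) hh
    rw [hS]; linarith
  have hyD : D * y ≤ S * m := by
    rcases le_or_gt D 0 with hD0 | hD0
    · linarith [mul_nonneg hS0 hm, mul_nonneg (neg_nonneg.2 hD0) hy]
    · have e1 : D * (γ ^ 2 - h - g) * y ≤ S * g * y := mul_le_mul_of_nonneg_right hDS hy
      have e2 : S * (g * y) ≤ S * ((γ ^ 2 - h - g) * m) :=
        mul_le_mul_of_nonneg_left (by linarith) hS0
      refine le_of_mul_le_mul_right (a := γ ^ 2 - h - g) ?_ hqH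
      linarith
  -- The tightest use of `x ≤ 1/5`: the difference is `x (8 - 39 x + 20 x²)`.
  have c1 : 1 + 10 * x ≤ (1 - x) ^ 2 * (1 + 20 * x) := by
    clear * - hx0 hx
    nlinarith [mul_nonneg hx0 hx0, mul_nonneg (mul_nonneg hx0 hx0) hx0,
      mul_nonneg hx0 (sub_nonneg.2 hx)]
  have hc0 : 0 ≤ (1 - x) ^ 2 := sq_nonneg _
  have hcg : 0 ≤ (1 - x) ^ 2 * (h + g) := by positivity
  have w1 : 0 ≤ ((1 - x) ^ 2 * (1 + 20 * x + h + g) - (1 + 10 * x)) * w :=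
    mul_nonneg (by linarith) hw
  have s1 : 0 ≤ ((1 - x) ^ 2 * (1 + 20 * x + h + g) - 1) * s :=
    mul_nonneg (by linarith) hs
  have z1 : 0 ≤ ((1 - x) ^ 2 * (1 + 20 * x + h + g) - (1 + x)) * (z - m) :=
    mul_nonneg (by linarith) (by linarith)
  have c2 : 0 ≤ (1 - x) ^ 2 * (1 + 20 * x) - (1 + x) ^ 2 - (x + x ^ 2) := by
    clear * - hx0 hx
    nlinarith [mul_nonneg hx0 hx0, mul_nonneg hx0 (sub_nonneg.2 hx)]
  have m1 := mul_nonneg c2 hm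
  have y1 : 0 ≤ ((1 - x) ^ 2 * (1 + 20 * x) - (1 + x)) * y := mul_nonneg (by linarith) hy
  have y2 : 0 ≤ x ^ 2 * h * y := by positivity
  rw [hD, hS] at hyD
  linarith

/-! ### Proper stable rational functions as functions on the closed unit disc -/

open Polynomial in
/-- The value at `z = 1 / ζ` of a proper rational function; at `ζ = 0` it is the value at infinity. -/
def diskEval (f : RatFunc ℝ) (ζ : ℂ) : ℂ :=
  aeval ζ (reflect f.denom.natDegree f.num) / aeval ζ (reflect f.denom.natDegree f.denom)

section Polynomial

open Polynomial

lemma aeval_reflect {ζ : ℂ} (hζ : ζ ≠ 0) {d : ℕ} {N : ℝ[X]} (hN : N.natDegree ≤ d) :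
    aeval ζ (reflect d N) = ζ ^ d * aeval ζ⁻¹ N := by
  let _ : Invertible ζ⁻¹ := ⟨ζ, mul_inv_cancel₀ hζ, inv_mul_cancel₀ hζ⟩
  have h := eval₂_reflect_mul_pow (algebraMap ℝ ℂ) ζ⁻¹ d N hN
  change eval₂ (algebraMap ℝ ℂ) ζ (reflect d N) * ζ⁻¹ ^ d = _ at h
  rw [aeval_def, aeval_def, ← h, inv_pow]
  field_simp

lemma aeval_reflect_zero (d : ℕ) (N : ℝ[X]) :
    aeval (0 : ℂ) (reflect d N) = (N.coeff d : ℂ) := by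
  rw [aeval_def, eval₂_at_zero, coeff_reflect]
  simp [revAt_le]

lemma aeval_reflect_ne_zero {D : ℝ[X]} (hD : D ≠ 0)
    (hst : ∀ z : ℂ, 1 ≤ ‖z‖ → aeval z D ≠ 0) {ζ : ℂ} (hζ : ‖ζ‖ ≤ 1) :
    aeval ζ (reflect D.natDegree D) ≠ 0 := by
  by_cases h0 : ζ = 0
  · subst h0
    rw [aeval_reflect_zero]
    exact_mod_cast leadingCoeff_ne_zero.2 hD
  · rw [aeval_reflect h0 le_rfl]
    refine mul_ne_zero (pow_ne_zero _ h0) (hst _ ?_)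
    rw [norm_inv]
    exact (one_le_inv₀ (norm_pos_iff.2 h0)).2 hζ

/-- Allows fractions that are not in lowest terms: the reduced denominator divides `D`, and
cancellation preserves the difference of degrees. -/
lemma IsProperStable.of_num_denom {f : RatFunc ℝ} {N D : ℝ[X]} (hD : D ≠ 0)
    (hfND : f.num * D = N * f.denom) (hdeg : N.natDegree ≤ D.natDegree)
    (hst : ∀ z : ℂ, 1 ≤ ‖z‖ → aeval z D ≠ 0) : IsProperStable f := by
  have hf : f = algebraMap _ _ N / algebraMap _ _ D := (RatFunc.num_mul_eq_mul_denom_iff hD).1 hfND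
  constructor
  · by_cases hN : f.num = 0
    · simp [hN]
    have hN' : N ≠ 0 := by
      rintro rfl
      simp [hN, hD] at hfND
    have := congrArg natDegree hfND
    rw [natDegree_mul hN hD, natDegree_mul hN' f.denom_ne_zero] at this
    omega
  · intro z hz h0
    have : f.denom ∣ D := by
      rw [hf]
      exact RatFunc.denom_div_dvd N D
    obtain ⟨E, hE⟩ := this
    exact hst z hz (by rw [hE, map_mul, h0, zero_mul])

/-- The value does not depend on the fraction or on the reversal degree: reverse the identity `f.num
* D = N * f.denom` at the total degree. Sums, products and resolvent entries are evaluated this way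
from unreduced fractions. -/
lemma diskEval_eq {f : RatFunc ℝ} (hf : IsProperStable f) {N D : ℝ[X]}
    (hfND : f.num * D = N * f.denom) {d : ℕ} (hNd : N.natDegree ≤ d) (hDd : D.natDegree ≤ d)
    {ζ : ℂ} (hζ : ‖ζ‖ ≤ 1) (hne : aeval ζ (reflect d D) ≠ 0) :
    diskEval f ζ = aeval ζ (reflect d N) / aeval ζ (reflect d D) := by
  have h := congrArg (fun P => aeval ζ (reflect (f.denom.natDegree + d) P)) hfND
  rw [reflect_mul _ _ hf.1 hDd, mul_comm N, reflect_mul _ _ le_rfl hNd, map_mul, map_mul] at h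
  rw [diskEval, div_eq_div_iff (aeval_reflect_ne_zero f.denom_ne_zero hf.2 hζ) hne, h, mul_comm]

lemma denom_mul_stable {f g : RatFunc ℝ} (hf : IsProperStable f) (hg : IsProperStable g) :
    ∀ z : ℂ, 1 ≤ ‖z‖ → aeval z (f.denom * g.denom) ≠ 0 := fun z hz => by
  rw [map_mul]
  exact mul_ne_zero (hf.2 z hz) (hg.2 z hz)

lemma denom_mul_ne_zero (f g : RatFunc ℝ) : f.denom * g.denom ≠ 0 :=
  mul_ne_zero f.denom_ne_zero g.denom_ne_zero

lemma natDegree_denom_mul (f g : RatFunc ℝ) :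
    (f.denom * g.denom).natDegree = f.denom.natDegree + g.denom.natDegree :=
  natDegree_mul f.denom_ne_zero g.denom_ne_zero

lemma natDegree_num_mul_le {f g : RatFunc ℝ} (hf : IsProperStable f) (hg : IsProperStable g) :
    (f.num * g.num).natDegree ≤ f.denom.natDegree + g.denom.natDegree :=
  natDegree_mul_le.trans (add_le_add hf.1 hg.1)

lemma natDegree_num_add_le {f g : RatFunc ℝ} (hf : IsProperStable f) (hg : IsProperStable g) :
    (f.num * g.denom + f.denom * g.num).natDegree ≤ f.denom.natDegree + g.denom.natDegree :=
  (natDegree_add_le _ _).trans <| max_le (natDegree_mul_le.trans (add_le_add hf.1 le_rfl))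
    (natDegree_mul_le.trans (add_le_add le_rfl hg.1))

lemma IsProperStable.mul {f g : RatFunc ℝ} (hf : IsProperStable f) (hg : IsProperStable g) :
    IsProperStable (f * g) :=
  .of_num_denom (denom_mul_ne_zero f g) (RatFunc.num_denom_mul f g)
    (by rw [natDegree_denom_mul]; exact natDegree_num_mul_le hf hg) (denom_mul_stable hf hg)

lemma IsProperStable.add {f g : RatFunc ℝ} (hf : IsProperStable f) (hg : IsProperStable g) :
    IsProperStable (f + g) :=
  .of_num_denom (denom_mul_ne_zero f g) (RatFunc.num_denom_add f g)
    (by rw [natDegree_denom_mul]; exact natDegree_num_add_le hf hg) (denom_mul_stable hf hg)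

lemma isProperStable_C (r : ℝ) : IsProperStable (RatFunc.C r) := by
  refine ⟨by simp [RatFunc.num_C, RatFunc.denom_C], fun z _ => ?_⟩
  simp [RatFunc.denom_C]

lemma IsProperStable.neg {f : RatFunc ℝ} (hf : IsProperStable f) : IsProperStable (-f) := by
  have := (isProperStable_C (-1)).mul hf
  simpa using this

lemma diskEval_mul {f g : RatFunc ℝ} (hf : IsProperStable f) (hg : IsProperStable g) {ζ : ℂ}
    (hζ : ‖ζ‖ ≤ 1) : diskEval (f * g) ζ = diskEval f ζ * diskEval g ζ := by
  have h1 := aeval_reflect_ne_zero f.denom_ne_zero hf.2 hζ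
  have h2 := aeval_reflect_ne_zero g.denom_ne_zero hg.2 hζ
  rw [diskEval_eq (hf.mul hg) (RatFunc.num_denom_mul f g)
    (natDegree_num_mul_le hf hg) (natDegree_denom_mul f g).le hζ]
  · rw [reflect_mul _ _ hf.1 hg.1, reflect_mul _ _ le_rfl le_rfl, map_mul, map_mul, diskEval,
      diskEval, div_mul_div_comm]
  · rw [reflect_mul _ _ le_rfl le_rfl, map_mul]
    exact mul_ne_zero h1 h2

lemma diskEval_add {f g : RatFunc ℝ} (hf : IsProperStable f) (hg : IsProperStable g) {ζ : ℂ}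
    (hζ : ‖ζ‖ ≤ 1) : diskEval (f + g) ζ = diskEval f ζ + diskEval g ζ := by
  have h1 := aeval_reflect_ne_zero f.denom_ne_zero hf.2 hζ
  have h2 := aeval_reflect_ne_zero g.denom_ne_zero hg.2 hζ
  rw [diskEval_eq (hf.add hg) (RatFunc.num_denom_add f g)
    (natDegree_num_add_le hf hg) (natDegree_denom_mul f g).le hζ]
  · rw [reflect_add, reflect_mul _ _ hf.1 le_rfl, reflect_mul _ _ le_rfl hg.1,
      reflect_mul _ _ le_rfl le_rfl, map_add, map_mul, map_mul, map_mul, diskEval,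
      diskEval, div_add_div _ _ h1 h2]
  · rw [reflect_mul _ _ le_rfl le_rfl, map_mul]
    exact mul_ne_zero h1 h2

lemma diskEval_C (r : ℝ) (ζ : ℂ) : diskEval (RatFunc.C r) ζ = r := by
  simp [diskEval, RatFunc.num_C, RatFunc.denom_C]

/-- The ring of proper stable rational functions. -/
def properStable : Subring (RatFunc ℝ) where
  carrier := {f | IsProperStable f}
  mul_mem' := IsProperStable.mul
  one_mem' := by simpa using isProperStable_C 1
  add_mem' := IsProperStable.add
  zero_mem' := by simpa using isProperStable_C 0
  neg_mem' := IsProperStable.neg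

/-- Evaluation of proper stable rational functions at a point of the closed unit disc. -/
def diskEvalHom {ζ : ℂ} (hζ : ‖ζ‖ ≤ 1) : properStable →+* ℂ where
  toFun f := diskEval f ζ
  map_one' := by simpa using diskEval_C 1 ζ
  map_zero' := by simpa using diskEval_C 0 ζ
  map_mul' f g := diskEval_mul f.2 g.2 hζ
  map_add' f g := diskEval_add f.2 g.2 hζ

/-- Nonvanishing at `ζ = 0` forces equal degrees of numerator and denominator, so the inverse is
proper; nonvanishing elsewhere leaves it no pole in `|z| ≥ 1`. -/
lemma IsProperStable.inv {f : RatFunc ℝ} (hf : IsProperStable f)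
    (h : ∀ ζ : ℂ, ‖ζ‖ ≤ 1 → diskEval f ζ ≠ 0) : IsProperStable f⁻¹ := by
  have h0 := h 0 (by simp)
  rw [diskEval, aeval_reflect_zero, aeval_reflect_zero, div_ne_zero_iff] at h0
  have hd : f.num.coeff f.denom.natDegree ≠ 0 := by exact_mod_cast h0.1
  have hN : f.num ≠ 0 := by
    intro hN
    simp [hN] at hd
  refine .of_num_denom (N := f.denom) hN ?_ (le_natDegree_of_ne_zero hd) ?_
  · rw [RatFunc.num_mul_eq_mul_denom_iff hN]
    conv_lhs => rw [← RatFunc.num_div_denom f]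
    rw [inv_div]
  · intro z hz hz0
    have hzn : z ≠ 0 := by
      rintro rfl
      norm_num at hz
    refine h z⁻¹ (by rw [norm_inv]; exact inv_le_one_of_one_le₀ hz) ?_
    rw [diskEval, aeval_reflect (inv_ne_zero hzn) hf.1, inv_inv, hz0, mul_zero, zero_div]

/-- `RatFunc.eval` respects sums and products only away from poles. On stable functions it is traded
here for `diskEval`, which is a ring homomorphism at each point of the closed disc and holomorphic
there. -/
lemma eval_exp_eq_diskEval {f : RatFunc ℝ} (hf : IsProperStable f) (ω : ℝ) :
    RatFunc.eval (algebraMap ℝ ℂ) (Complex.exp (ω * Complex.I)) f =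
      diskEval f (Complex.exp (-(ω * Complex.I))) := by
  have h0 := Complex.exp_ne_zero (-(ω * Complex.I))
  rw [diskEval, aeval_reflect h0 hf.1, aeval_reflect h0 le_rfl,
    mul_div_mul_left _ _ (pow_ne_zero _ h0), ← Complex.exp_neg, neg_neg, RatFunc.eval, aeval_def,
    aeval_def]

lemma diskEval_differentiableAt {f : RatFunc ℝ} (hf : IsProperStable f) {ζ : ℂ} (hζ : ‖ζ‖ ≤ 1) :
    DifferentiableAt ℂ (diskEval f) ζ := by
  unfold diskEval
  exact (Polynomial.differentiableAt_aeval _).div (Polynomial.differentiableAt_aeval _)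
    (aeval_reflect_ne_zero f.denom_ne_zero hf.2 hζ)

end Polynomial

lemma diskEval_diffContOnCl {f : RatFunc ℝ} (hf : IsProperStable f) :
    DiffContOnCl ℂ (diskEval f) (Metric.ball 0 1) := by
  refine ⟨fun ζ hζ => (diskEval_differentiableAt hf ?_).differentiableWithinAt, fun ζ hζ =>
    (diskEval_differentiableAt hf ?_).continuousAt.continuousWithinAt⟩
  · exact (mem_ball_zero_iff.1 hζ).le
  · rw [closure_ball _ one_ne_zero] at hζ
    exact mem_closedBall_zero_iff.1 hζ

lemma norm_exp_neg_mul_I (ω : ℝ) : ‖Complex.exp (-(ω * Complex.I))‖ = 1 := by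
  have := Complex.norm_exp_ofReal_mul_I (-ω)
  rwa [Complex.ofReal_neg, neg_mul] at this

lemma diskEval_circle_continuous {f : RatFunc ℝ} (hf : IsProperStable f) :
    Continuous fun ω : ℝ => diskEval f (Complex.exp (-(ω * Complex.I))) := by
  rw [continuous_iff_continuousAt]
  intro ω
  exact ContinuousAt.comp (f := fun ω : ℝ => Complex.exp (-(ω * Complex.I)))
    (diskEval_differentiableAt hf (norm_exp_neg_mul_I ω).le).continuousAt
    (by fun_prop)

/-- The mean value property on the unit circle. -/
lemma integral_diskEval {f : RatFunc ℝ} (hf : IsProperStable f) :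
    ∫ ω in (-Real.pi)..Real.pi, diskEval f (Complex.exp (-(ω * Complex.I))) =
      2 * Real.pi * diskEval f 0 := by
  have h := DiffContOnCl.circleAverage (f := diskEval f) (c := 0) (R := 1)
    (by simpa using diskEval_diffContOnCl hf)
  rw [Real.circleAverage_eq_integral_add (-Real.pi), inv_smul_eq_iff₀ (by positivity)] at h
  -- The frequency response runs through the circle clockwise, as `ζ = e^{-iω}`; the reflection
  -- restores the orientation of `circleMap`.
  have e := intervalIntegral.integral_comp_neg (a := -Real.pi) (b := Real.pi)
    fun ω : ℝ => diskEval f (Complex.exp (-(ω * Complex.I)))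
  rw [neg_neg] at e
  rw [← e]
  simp only [Complex.ofReal_neg, neg_mul, neg_neg]
  rw [intervalIntegral.integral_comp_add_right (fun θ => diskEval f (circleMap 0 1 θ))] at h
  simp only [circleMap, Complex.ofReal_one, one_mul, zero_add, Complex.real_smul] at h
  convert h using 2
  · ring
  · push_cast; ring

/-! ### Stable transfer matrices -/

section StableMatrices

variable {ι κ τ : Type}

/-- The value at `z = 1 / ζ` of a transfer matrix. -/
def diskMat (G : TransferMatrix ι κ) (ζ : ℂ) : Matrix ι κ ℂ := G.map fun f => diskEval f ζ

lemma freqResponse_eq_diskMat {G : TransferMatrix ι κ} (hG : InRHinf G) (ω : ℝ) :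
    freqResponse G ω = diskMat G (Complex.exp (-(ω * Complex.I))) := by
  ext i j
  exact eval_exp_eq_diskEval (hG i j) ω

lemma InRHinf.add {G H : TransferMatrix ι κ} (hG : InRHinf G) (hH : InRHinf H) :
    InRHinf (G + H) := fun i j => (hG i j).add (hH i j)

lemma InRHinf.neg {G : TransferMatrix ι κ} (hG : InRHinf G) : InRHinf (-G) :=
  fun i j => (hG i j).neg

lemma InRHinf.sub {G H : TransferMatrix ι κ} (hG : InRHinf G) (hH : InRHinf H) :
    InRHinf (G - H) := by
  rw [sub_eq_add_neg]
  exact hG.add hH.neg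

lemma InRHinf.mul [Fintype κ] {G : TransferMatrix ι κ} {H : TransferMatrix κ τ} (hG : InRHinf G)
    (hH : InRHinf H) : InRHinf (G * H) :=
  fun i j => properStable.sum_mem fun k _ => (hG i k).mul (hH k j)

lemma inRHinf_constTM (M : Matrix ι κ ℝ) : InRHinf (constTM M) := fun i j => isProperStable_C (M i j)

lemma constTM_one [DecidableEq ι] : constTM (1 : Matrix ι ι ℝ) = 1 := by
  simp [constTM]

lemma constTM_zero : constTM (0 : Matrix ι κ ℝ) = 0 := by
  simp [constTM]

lemma inRHinf_one [DecidableEq ι] : InRHinf (1 : TransferMatrix ι ι) := by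
  rw [← constTM_one]
  exact inRHinf_constTM 1

lemma inRHinf_zero : InRHinf (0 : TransferMatrix ι κ) := by
  rw [← constTM_zero]
  exact inRHinf_constTM 0

lemma diskMat_add {G H : TransferMatrix ι κ} (hG : InRHinf G) (hH : InRHinf H) {ζ : ℂ}
    (hζ : ‖ζ‖ ≤ 1) : diskMat (G + H) ζ = diskMat G ζ + diskMat H ζ := by
  ext i j
  exact diskEval_add (hG i j) (hH i j) hζ

lemma diskMat_neg {G : TransferMatrix ι κ} (hG : InRHinf G) {ζ : ℂ} (hζ : ‖ζ‖ ≤ 1) :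
    diskMat (-G) ζ = -diskMat G ζ := by
  ext i j
  have h := diskEval_mul (isProperStable_C (-1)) (hG i j) hζ
  rw [diskEval_C] at h
  simpa [diskMat] using h

lemma diskMat_sub {G H : TransferMatrix ι κ} (hG : InRHinf G) (hH : InRHinf H) {ζ : ℂ}
    (hζ : ‖ζ‖ ≤ 1) : diskMat (G - H) ζ = diskMat G ζ - diskMat H ζ := by
  rw [sub_eq_add_neg, diskMat_add hG hH.neg hζ, diskMat_neg hH hζ, sub_eq_add_neg]

lemma diskMat_mul [Fintype κ] {G : TransferMatrix ι κ} {H : TransferMatrix κ τ} (hG : InRHinf G)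
    (hH : InRHinf H) {ζ : ℂ} (hζ : ‖ζ‖ ≤ 1) : diskMat (G * H) ζ = diskMat G ζ * diskMat H ζ := by
  ext i j
  have h := map_sum (diskEvalHom hζ)
    (fun k => (⟨G i k, hG i k⟩ * ⟨H k j, hH k j⟩ : properStable)) Finset.univ
  simp only [map_mul] at h
  convert h using 1
  · simp only [diskMat, map_apply, mul_apply, diskEvalHom, RingHom.coe_mk, MonoidHom.coe_mk,
      OneHom.coe_mk, AddSubmonoidClass.coe_finsetSum]
    rfl
  · rw [mul_apply]
    rfl

lemma diskMat_one [DecidableEq ι] (ζ : ℂ) : diskMat (1 : TransferMatrix ι ι) ζ = 1 := by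
  ext i j
  by_cases h : i = j
  · subst h
    simpa [diskMat] using diskEval_C 1 ζ
  · simpa [diskMat, h] using diskEval_C 0 ζ

lemma InRHinf.det [Fintype ι] [DecidableEq ι] {G : TransferMatrix ι ι} (hG : InRHinf G) :
    IsProperStable G.det := by
  rw [det_apply]
  exact properStable.sum_mem fun σ _ => properStable.zsmul_mem
    (properStable.prod_mem fun i _ => hG (σ i) i) _

lemma diskEval_det [Fintype ι] [DecidableEq ι] {G : TransferMatrix ι ι} (hG : InRHinf G) {ζ : ℂ}
    (hζ : ‖ζ‖ ≤ 1) : diskEval G.det ζ = (diskMat G ζ).det := by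
  let G' : Matrix ι ι properStable := fun i j => ⟨G i j, hG i j⟩
  have h1 : G.det = properStable.subtype G'.det := by
    rw [RingHom.map_det]
    rfl
  have h2 : (diskMat G ζ).det = diskEvalHom hζ G'.det := by
    rw [RingHom.map_det]
    rfl
  rw [h1, h2]
  rfl

/-- Cramer's rule: the adjugate has stable entries, and the determinant is a unit among proper
stable functions because it has no zero on the closed disc. -/
lemma InRHinf.inv [Fintype ι] [DecidableEq ι] {G : TransferMatrix ι ι} (hG : InRHinf G)
    (h : ∀ ζ : ℂ, ‖ζ‖ ≤ 1 → (diskMat G ζ).det ≠ 0) : InRHinf G⁻¹ := by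
  have hdet : IsProperStable (G.det)⁻¹ :=
    hG.det.inv fun ζ hζ => by rw [diskEval_det hG hζ]; exact h ζ hζ
  intro i j
  rw [inv_def, Ring.inverse_eq_inv', Matrix.smul_apply, smul_eq_mul]
  refine hdet.mul ?_
  rw [adjugate_apply]
  refine InRHinf.det fun k l => ?_
  rw [updateRow_apply]
  split_ifs with hk
  · by_cases hl : l = i
    · subst hl; simpa using isProperStable_C 1
    · simpa [hl] using isProperStable_C 0
  · exact hG k l

lemma isUnit_det_of_diskMat [Fintype ι] [DecidableEq ι] {G : TransferMatrix ι ι} (hG : InRHinf G)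
    {ζ : ℂ} (hζ : ‖ζ‖ ≤ 1) (h : (diskMat G ζ).det ≠ 0) : IsUnit G.det := by
  rw [isUnit_iff_ne_zero]
  intro h0
  rw [← diskEval_det hG hζ, h0] at h
  exact h (by simpa using diskEval_C 0 ζ)

lemma freqResponse_add {G H : TransferMatrix ι κ} (hG : InRHinf G) (hH : InRHinf H) (ω : ℝ) :
    freqResponse (G + H) ω = freqResponse G ω + freqResponse H ω := by
  rw [freqResponse_eq_diskMat hG, freqResponse_eq_diskMat hH, freqResponse_eq_diskMat (hG.add hH),
    diskMat_add hG hH (norm_exp_neg_mul_I ω).le]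

lemma freqResponse_sub {G H : TransferMatrix ι κ} (hG : InRHinf G) (hH : InRHinf H) (ω : ℝ) :
    freqResponse (G - H) ω = freqResponse G ω - freqResponse H ω := by
  rw [freqResponse_eq_diskMat hG, freqResponse_eq_diskMat hH, freqResponse_eq_diskMat (hG.sub hH),
    diskMat_sub hG hH (norm_exp_neg_mul_I ω).le]

lemma freqResponse_mul [Fintype κ] {G : TransferMatrix ι κ} {H : TransferMatrix κ τ}
    (hG : InRHinf G) (hH : InRHinf H) (ω : ℝ) :
    freqResponse (G * H) ω = freqResponse G ω * freqResponse H ω := by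
  rw [freqResponse_eq_diskMat hG, freqResponse_eq_diskMat hH, freqResponse_eq_diskMat (hG.mul hH),
    diskMat_mul hG hH (norm_exp_neg_mul_I ω).le]

lemma freqResponse_one [DecidableEq ι] (ω : ℝ) :
    freqResponse (1 : TransferMatrix ι ι) ω = 1 := by
  rw [freqResponse_eq_diskMat inRHinf_one, diskMat_one]

lemma freqResponse_continuous {G : TransferMatrix ι κ} (hG : InRHinf G) (i : ι) (j : κ) :
    Continuous fun ω => freqResponse G ω i j := by
  simp only [freqResponse_eq_diskMat hG]
  exact diskEval_circle_continuous (hG i j)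

/-! ### Frobenius norm and largest singular value -/

/-- The Frobenius norm of a complex matrix. -/
def frob [Fintype ι] [Fintype κ] (M : Matrix ι κ ℂ) : ℝ := √(∑ i, ∑ j, ‖M i j‖ ^ 2)

variable [Fintype ι] [Fintype κ] [Fintype τ]

lemma frob_nonneg (M : Matrix ι κ ℂ) : 0 ≤ frob M := Real.sqrt_nonneg _

lemma frob_sq (M : Matrix ι κ ℂ) : frob M ^ 2 = ∑ i, ∑ j, ‖M i j‖ ^ 2 :=
  Real.sq_sqrt (by positivity)

section
attribute [local instance] Matrix.frobeniusNormedAddCommGroup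

lemma frob_eq_norm (M : Matrix ι κ ℂ) : frob M = ‖M‖ := by
  rw [frobenius_norm_def, frob, Real.sqrt_eq_rpow]
  simp

lemma frob_add_le (M N : Matrix ι κ ℂ) : frob (M + N) ≤ frob M + frob N := by
  simp only [frob_eq_norm]
  exact norm_add_le M N

lemma frob_neg (M : Matrix ι κ ℂ) : frob (-M) = frob M := by
  simp only [frob_eq_norm, norm_neg]

end

lemma frob_sub_le (M N : Matrix ι κ ℂ) : frob (M - N) ≤ frob M + frob N := by
  rw [sub_eq_add_neg, ← frob_neg N]
  exact frob_add_le M (-N)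

lemma frob_conjTranspose (M : Matrix ι κ ℂ) : frob Mᴴ = frob M := by
  rw [frob, frob, Finset.sum_comm]
  simp

lemma frob_one_sq [DecidableEq ι] : frob (1 : Matrix ι ι ℂ) ^ 2 = Fintype.card ι := by
  rw [frob_sq]
  have : ∀ i j : ι, ‖(1 : Matrix ι ι ℂ) i j‖ ^ 2 = if i = j then 1 else 0 := by
    intro i j
    by_cases h : i = j
    · subst h; simp
    · simp [h]
  simp [this]

lemma frob_fromBlocks_sq {ι' κ' : Type} [Fintype ι'] [Fintype κ'] (A : Matrix ι κ ℂ)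
    (B : Matrix ι κ' ℂ) (C : Matrix ι' κ ℂ) (D : Matrix ι' κ' ℂ) :
    frob (fromBlocks A B C D) ^ 2 = frob A ^ 2 + frob B ^ 2 + frob C ^ 2 + frob D ^ 2 := by
  simp only [frob_sq, Fintype.sum_sum_type, fromBlocks_apply₁₁, fromBlocks_apply₁₂,
    fromBlocks_apply₂₁, fromBlocks_apply₂₂, Finset.sum_add_distrib]
  ring

variable [DecidableEq κ]

lemma sigmaMax_nonneg (M : Matrix ι κ ℂ) : 0 ≤ sigmaMax M := norm_nonneg _

lemma norm_mulVec_le (M : Matrix ι κ ℂ) (v : κ → ℂ) :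
    ‖WithLp.toLp 2 (M *ᵥ v)‖ ≤ sigmaMax M * ‖WithLp.toLp 2 v‖ :=
  (LinearMap.toContinuousLinearMap (Matrix.toEuclideanLin M)).le_opNorm (WithLp.toLp 2 v)

lemma sigmaMax_conjTranspose [DecidableEq ι] (M : Matrix ι κ ℂ) : sigmaMax Mᴴ = sigmaMax M :=
  Matrix.l2_opNorm_conjTranspose M

lemma sigmaMax_mul_le [DecidableEq τ] (M : Matrix ι κ ℂ) (N : Matrix κ τ ℂ) :
    sigmaMax (M * N) ≤ sigmaMax M * sigmaMax N :=
  Matrix.l2_opNorm_mul M N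

lemma sigmaMax_sub_comm (M N : Matrix ι κ ℂ) : sigmaMax (M - N) = sigmaMax (N - M) := by
  simp only [sigmaMax, map_sub]
  exact norm_sub_rev _ _

lemma sigmaMax_add_le (M N : Matrix ι κ ℂ) : sigmaMax (M + N) ≤ sigmaMax M + sigmaMax N := by
  simp only [sigmaMax, map_add]
  exact norm_add_le _ _

/-- Apply the operator norm bound to each column of `N` and add the squares. -/
lemma frob_mul_le (M : Matrix ι κ ℂ) (N : Matrix κ τ ℂ) :
    frob (M * N) ≤ sigmaMax M * frob N := by
  refine Real.sqrt_le_iff.2 ⟨mul_nonneg (sigmaMax_nonneg M) (frob_nonneg N), ?_⟩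
  rw [mul_pow, frob_sq, Finset.sum_comm, Finset.sum_comm (s := Finset.univ (α := κ)),
    Finset.mul_sum]
  refine Finset.sum_le_sum fun j _ => ?_
  have h := pow_le_pow_left₀ (norm_nonneg _) (norm_mulVec_le M fun k => N k j) 2
  rw [mul_pow, EuclideanSpace.norm_sq_eq, EuclideanSpace.norm_sq_eq] at h
  exact h

lemma frob_mul_le' [DecidableEq τ] (M : Matrix ι κ ℂ) (N : Matrix κ τ ℂ) :
    frob (M * N) ≤ frob M * sigmaMax N := by
  classical
  rw [← frob_conjTranspose, conjTranspose_mul, mul_comm]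
  refine (frob_mul_le _ _).trans ?_
  rw [sigmaMax_conjTranspose, frob_conjTranspose]

lemma frob_le_sigmaMax (M : Matrix ι κ ℂ) : frob M ≤ sigmaMax M * √(Fintype.card κ) := by
  have h := frob_mul_le M (1 : Matrix κ κ ℂ)
  rwa [Matrix.mul_one, ← Real.sqrt_sq (frob_nonneg (1 : Matrix κ κ ℂ)), frob_one_sq] at h

end StableMatrices

/-! ### The `H_∞` norm -/

section Norms

variable {ι κ : Type} [Fintype ι] [Fintype κ] [DecidableEq κ]

/-- The operator norm, as a function on matrices, is continuous. -/
lemma continuous_sigmaMax : Continuous fun M : Matrix ι κ ℂ => sigmaMax M := by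
  have h : Continuous ((LinearMap.toContinuousLinearMap.toLinearMap).comp
      (Matrix.toEuclideanLin (𝕜 := ℂ) (m := ι) (n := κ)).toLinearMap) :=
    LinearMap.continuous_of_finiteDimensional _
  exact continuous_norm.comp h

lemma diskMat_continuousOn {ι κ : Type} {G : TransferMatrix ι κ} (hG : InRHinf G) :
    ContinuousOn (diskMat G) (Metric.closedBall 0 1) := by
  refine continuousOn_pi.2 fun i => continuousOn_pi.2 fun j ζ hζ => ?_
  exact (diskEval_differentiableAt (hG i j)
    (mem_closedBall_zero_iff.1 hζ)).continuousAt.continuousWithinAt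

lemma bddAbove_sigmaMax {G : TransferMatrix ι κ} (hG : InRHinf G) :
    BddAbove (Set.range fun ω : ℝ => sigmaMax (freqResponse G ω)) := by
  have h := (isCompact_closedBall (0 : ℂ) 1).bddAbove_image
    (continuous_sigmaMax.comp_continuousOn (diskMat_continuousOn hG))
  refine h.mono ?_
  rintro _ ⟨ω, rfl⟩
  refine ⟨Complex.exp (-(ω * Complex.I)), ?_, ?_⟩
  · rw [mem_closedBall_zero_iff, norm_exp_neg_mul_I]
  · simp only [Function.comp_apply, freqResponse_eq_diskMat hG]

lemma sigmaMax_le_hinfNorm {G : TransferMatrix ι κ} (hG : InRHinf G) (ω : ℝ) :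
    sigmaMax (freqResponse G ω) ≤ hinfNorm G :=
  le_ciSup (bddAbove_sigmaMax hG) ω

lemma hinfNorm_nonneg (G : TransferMatrix ι κ) : 0 ≤ hinfNorm G :=
  Real.iSup_nonneg fun _ => sigmaMax_nonneg _

lemma hinfNorm_zero : hinfNorm (0 : TransferMatrix ι κ) = 0 := by
  have : ∀ ω : ℝ, sigmaMax (freqResponse (0 : TransferMatrix ι κ) ω) = 0 := by
    intro ω
    have : freqResponse (0 : TransferMatrix ι κ) ω = 0 := by
      ext i j
      simp [freqResponse]
    rw [this]
    simp [sigmaMax]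
  simp [hinfNorm, this]

lemma hinfNorm_le_add_sub {G H : TransferMatrix ι κ} (hG : InRHinf G) (hH : InRHinf H) :
    hinfNorm H ≤ hinfNorm G + hinfNorm (G - H) := by
  refine Real.iSup_le (fun ω => ?_) (add_nonneg (hinfNorm_nonneg _) (hinfNorm_nonneg _))
  have h1 := sigmaMax_add_le (freqResponse G ω) (freqResponse H ω - freqResponse G ω)
  rw [add_sub_cancel, sigmaMax_sub_comm, ← freqResponse_sub hG hH] at h1
  exact h1.trans (add_le_add (sigmaMax_le_hinfNorm hG ω) (sigmaMax_le_hinfNorm (hG.sub hH) ω))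

/-! ### The maximum modulus principle and the small gain theorem -/

/-- Maximum modulus principle for a holomorphic function with values in the normed space of
operators; a bound on the frequencies extends to the closed disc. -/
lemma sigmaMax_diskMat_le {G : TransferMatrix ι κ} (hG : InRHinf G) {c : ℝ}
    (h : ∀ ω, sigmaMax (freqResponse G ω) ≤ c) {ζ : ℂ} (hζ : ‖ζ‖ ≤ 1) :
    sigmaMax (diskMat G ζ) ≤ c := by
  let L : (ι → κ → ℂ) →ₗ[ℂ] (EuclideanSpace ℂ κ →L[ℂ] EuclideanSpace ℂ ι) :=
    (LinearMap.toContinuousLinearMap.toLinearMap).comp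
      (Matrix.toEuclideanLin (𝕜 := ℂ) (m := ι) (n := κ)).toLinearMap
  have hL : Differentiable ℂ L :=
    (LinearMap.toContinuousLinearMap L).differentiable
  have hd : DiffContOnCl ℂ (fun ζ => L (fun i j => diskMat G ζ i j)) (Metric.ball 0 1) := by
    refine hL.comp_diffContOnCl ?_
    refine ⟨?_, ?_⟩
    · rw [differentiableOn_pi]
      intro i
      rw [differentiableOn_pi]
      intro j
      exact (diskEval_diffContOnCl (hG i j)).differentiableOn
    · rw [closure_ball _ one_ne_zero]
      exact diskMat_continuousOn hG
  refine Complex.norm_le_of_forall_mem_frontier_norm_le Metric.isBounded_ball hd ?_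
    (z := ζ) (by rw [closure_ball _ one_ne_zero]; exact mem_closedBall_zero_iff.2 hζ)
  intro z hz
  rw [frontier_ball _ one_ne_zero, mem_sphere_zero_iff_norm] at hz
  have hz' : z = Complex.exp (-((-z.arg : ℝ) * Complex.I)) := by
    have := Complex.norm_mul_exp_arg_mul_I z
    rw [hz, Complex.ofReal_one, one_mul] at this
    rw [Complex.ofReal_neg, neg_mul, neg_neg, this]
  have := h (-z.arg)
  rwa [freqResponse_eq_diskMat hG, ← hz'] at this

/-- A kernel vector of `1 - M` would be a nonzero fixed vector of a strict contraction. -/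
lemma det_one_sub_ne_zero {M : Matrix κ κ ℂ} (h : sigmaMax M < 1) : (1 - M).det ≠ 0 := by
  intro h0
  obtain ⟨v, hv, hv0⟩ := exists_mulVec_eq_zero_iff.2 h0
  rw [sub_mulVec, one_mulVec, sub_eq_zero] at hv0
  have h1 := norm_mulVec_le M v
  rw [← hv0] at h1
  have h2 : 0 < ‖WithLp.toLp 2 v‖ := by
    rw [norm_pos_iff]
    simpa using hv
  nlinarith

/-- The small gain theorem. -/
lemma det_diskMat_one_sub_ne_zero {P : TransferMatrix κ κ} (hP : InRHinf P) {c : ℝ} (hc : c < 1)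
    (h : ∀ ω, sigmaMax (freqResponse P ω) ≤ c) {ζ : ℂ} (hζ : ‖ζ‖ ≤ 1) :
    (diskMat (1 - P) ζ).det ≠ 0 := by
  rw [diskMat_sub inRHinf_one hP hζ, diskMat_one]
  exact det_one_sub_ne_zero ((sigmaMax_diskMat_le hP h hζ).trans_lt hc)

/-! ### The `H_2` norm -/

end Norms

section MeanSquare

variable {ι κ : Type} [Fintype ι] [Fintype κ]

lemma continuous_frob_sq {G : TransferMatrix ι κ} (hG : InRHinf G) :
    Continuous fun ω => frob (freqResponse G ω) ^ 2 := by
  simp only [frob_sq]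
  exact continuous_finsetSum _ fun i _ => continuous_finsetSum _ fun j _ =>
    (freqResponse_continuous hG i j).norm.pow 2

/-- The mean over the frequencies. -/
def freqMean (f : ℝ → ℝ) : ℝ := (1 / (2 * Real.pi)) * ∫ ω in (-Real.pi)..Real.pi, f ω

lemma freqMean_mono {f g : ℝ → ℝ} (hf : Continuous f) (hg : Continuous g) (h : ∀ ω, f ω ≤ g ω) :
    freqMean f ≤ freqMean g := by
  have := Real.pi_pos
  refine mul_le_mul_of_nonneg_left ?_ (by positivity)
  exact intervalIntegral.integral_mono_on (by linarith) (hf.intervalIntegrable _ _)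
    (hg.intervalIntegrable _ _) fun ω _ => h ω

lemma freqMean_add {f g : ℝ → ℝ} (hf : Continuous f) (hg : Continuous g) :
    freqMean (fun ω => f ω + g ω) = freqMean f + freqMean g := by
  rw [freqMean, intervalIntegral.integral_add (hf.intervalIntegrable _ _)
    (hg.intervalIntegrable _ _), mul_add]
  rfl

lemma freqMean_const_mul (c : ℝ) (f : ℝ → ℝ) :
    freqMean (fun ω => c * f ω) = c * freqMean f := by
  rw [freqMean, intervalIntegral.integral_const_mul, freqMean]
  ring

lemma freqMean_const (c : ℝ) : freqMean (fun _ => c) = c := by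
  have := Real.pi_pos
  rw [freqMean, intervalIntegral.integral_const, smul_eq_mul]
  field_simp
  ring

lemma freqMean_nonneg {f : ℝ → ℝ} (h : ∀ ω, 0 ≤ f ω) : 0 ≤ freqMean f := by
  have := Real.pi_pos
  exact mul_nonneg (by positivity) (intervalIntegral.integral_nonneg (by linarith) fun ω _ => h ω)

/-- The squared `H_2` norm. -/
def h2Sq (G : TransferMatrix ι κ) : ℝ := freqMean fun ω => frob (freqResponse G ω) ^ 2

lemma h2Sq_nonneg (G : TransferMatrix ι κ) : 0 ≤ h2Sq G := freqMean_nonneg fun _ => sq_nonneg _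

lemma h2Norm_sq (G : TransferMatrix ι κ) : h2Norm G ^ 2 = h2Sq G := by
  have h : h2Norm G = √(h2Sq G) := by
    simp only [h2Sq, frob_sq]
    rfl
  rw [h, Real.sq_sqrt (h2Sq_nonneg G)]

lemma h2Norm_nonneg (G : TransferMatrix ι κ) : 0 ≤ h2Norm G := Real.sqrt_nonneg _

lemma h2Sq_fromBlocks {ι' κ' : Type} [Fintype ι'] [Fintype κ'] {P : TransferMatrix ι κ}
    {Q : TransferMatrix ι κ'} {R : TransferMatrix ι' κ} {S : TransferMatrix ι' κ'}
    (hP : InRHinf P) (hQ : InRHinf Q) (hR : InRHinf R) (hS : InRHinf S) :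
    h2Sq (fromBlocks P Q R S) = h2Sq P + h2Sq Q + h2Sq R + h2Sq S := by
  have h : ∀ ω, freqResponse (fromBlocks P Q R S) ω = fromBlocks (freqResponse P ω)
      (freqResponse Q ω) (freqResponse R ω) (freqResponse S ω) := fun ω => fromBlocks_map _ _ _ _ _
  simp only [h2Sq, h, frob_fromBlocks_sq]
  have hP' := continuous_frob_sq hP
  have hQ' := continuous_frob_sq hQ
  have hR' := continuous_frob_sq hR
  rw [freqMean_add (by fun_prop) (continuous_frob_sq hS), freqMean_add (by fun_prop) hR',
    freqMean_add hP' hQ']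

lemma InRHinf.smul {ι κ : Type} {G : TransferMatrix ι κ} (hG : InRHinf G) (c : ℝ) :
    InRHinf ((RatFunc.C c : RatFunc ℝ) • G) := fun i j => (isProperStable_C c).mul (hG i j)

lemma h2Sq_smul {G : TransferMatrix ι κ} (hG : InRHinf G) (c : ℝ) :
    h2Sq ((RatFunc.C c : RatFunc ℝ) • G) = c ^ 2 * h2Sq G := by
  rw [h2Sq, h2Sq, ← freqMean_const_mul]
  congr 1
  ext ω
  have h : ∀ i j, freqResponse ((RatFunc.C c : RatFunc ℝ) • G) ω i j =
      c * freqResponse G ω i j := by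
    intro i j
    rw [freqResponse_eq_diskMat (hG.smul c), freqResponse_eq_diskMat hG]
    have := diskEval_mul (isProperStable_C c) (hG i j) (norm_exp_neg_mul_I ω).le
    rwa [diskEval_C] at this
  simp only [frob_sq, h, norm_mul, mul_pow, Finset.mul_sum]
  simp

/-- By the mean value property, a stable system with value `1` at infinity has `H_2` norm at least
that of the identity. -/
lemma card_le_h2Sq [DecidableEq ι] {G : TransferMatrix ι ι} (hG : InRHinf G)
    (h0 : diskMat G 0 = 1) : (Fintype.card ι : ℝ) ≤ h2Sq G := by
  -- Each diagonal entry has mean `1`, its value at infinity. Summing `|c|² ≥ 2 Re c - 1` over the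
  -- diagonal then gives the bound.
  have hre : ∀ i, freqMean (fun ω => (freqResponse G ω i i).re) = 1 := by
    intro i
    have h1 := integral_diskEval (hG i i)
    have h2 : diskEval (G i i) 0 = 1 := by
      have := congrFun (congrFun h0 i) i
      simpa [diskMat] using this
    have h3 := congrArg Complex.re h1
    rw [← Complex.reCLM_apply, ← ContinuousLinearMap.intervalIntegral_comp_comm _
      ((diskEval_circle_continuous (hG i i)).intervalIntegrable _ _), h2, mul_one] at h3
    have := Real.pi_pos
    simp only [freqMean, freqResponse_eq_diskMat hG]
    simp only [Complex.reCLM_apply] at h3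
    change 1 / (2 * Real.pi) * ∫ ω in (-Real.pi)..Real.pi,
      (diskEval (G i i) (Complex.exp (-(ω * Complex.I)))).re = 1
    rw [h3]
    have : ((2 : ℂ) * Real.pi).re = 2 * Real.pi := by simp
    rw [this]
    field_simp
  have hc : ∀ i, Continuous fun ω => (freqResponse G ω i i).re := fun i =>
    Complex.continuous_re.comp (freqResponse_continuous hG i i)
  have hsum : ∀ s : Finset ι, freqMean (fun ω => ∑ i ∈ s, (2 * (freqResponse G ω i i).re + -1)) =
      s.card := by
    classical
    intro s
    induction s using Finset.induction_on with
    | empty => simpa using freqMean_const 0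
    | insert a s ha ih =>
      simp only [Finset.sum_insert ha, Finset.card_insert_of_notMem ha]
      rw [freqMean_add (by have := hc a; fun_prop)
        (continuous_finsetSum _ fun i _ => by have := hc i; fun_prop), ih,
        freqMean_add (by have := hc a; fun_prop) continuous_const, freqMean_const_mul, hre,
        freqMean_const]
      push_cast
      ring
  rw [← Finset.card_univ, ← hsum Finset.univ]
  refine freqMean_mono (continuous_finsetSum _ fun i _ => by have := hc i; fun_prop)
    (continuous_frob_sq hG) fun ω => ?_
  rw [frob_sq]
  refine Finset.sum_le_sum fun i _ => ?_
  have h1 : ‖freqResponse G ω i i‖ ^ 2 ≤ ∑ j, ‖freqResponse G ω i j‖ ^ 2 :=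
    Finset.single_le_sum (f := fun j => ‖freqResponse G ω i j‖ ^ 2)
      (fun j _ => sq_nonneg _) (Finset.mem_univ i)
  have h2 := Complex.re_le_norm (freqResponse G ω i i)
  nlinarith [sq_nonneg (‖freqResponse G ω i i‖ - 1)]

end MeanSquare

/-! ### Schur stable matrices and their resolvents -/

section Schur

variable {ι : Type} [Fintype ι] [DecidableEq ι]

lemma mem_spectrum_iff_exists_mulVec {M : Matrix ι ι ℂ} {z : ℂ} :
    z ∈ spectrum ℂ M ↔ ∃ v, v ≠ 0 ∧ M *ᵥ v = z • v := by
  rw [spectrum.mem_iff, isUnit_iff_isUnit_det, isUnit_iff_ne_zero, not_not,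
    ← exists_mulVec_eq_zero_iff]
  refine exists_congr fun v => and_congr_right fun _ => ?_
  rw [sub_mulVec, sub_eq_zero, Algebra.algebraMap_eq_smul_one, smul_mulVec, one_mulVec, eq_comm]

lemma schurStable_iff {M : Matrix ι ι ℝ} : SchurStable M ↔
    ∀ (z : ℂ) (v : ι → ℂ), 1 ≤ ‖z‖ → M.map Complex.ofReal *ᵥ v = z • v → v = 0 := by
  constructor
  · intro h z v hz hv
    by_contra hv0
    have h1 : (‖z‖₊ : ENNReal) ≤ spectralRadius ℂ (M.map Complex.ofReal) :=
      le_iSup₂ (f := fun k (_ : k ∈ spectrum ℂ (M.map Complex.ofReal)) => (‖k‖₊ : ENNReal)) z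
        (mem_spectrum_iff_exists_mulVec.2 ⟨v, hv0, hv⟩)
    have h2 : (‖z‖₊ : ENNReal) < 1 := h1.trans_lt h
    have h3 : ‖z‖₊ < 1 := by exact_mod_cast h2
    exact absurd (show ‖z‖ < 1 from h3) (not_lt.2 hz)
  · intro h
    have hfin : (spectrum ℂ (M.map Complex.ofReal)).Finite := by
      refine ((M.map Complex.ofReal).charpoly.roots.toFinset.finite_toSet).subset fun z hz => ?_
      have := (M.map Complex.ofReal).charpoly_monic.ne_zero
      simpa [this] using mem_spectrum_iff_isRoot_charpoly.1 hz
    have hlt : ∀ z ∈ spectrum ℂ (M.map Complex.ofReal), (‖z‖₊ : ENNReal) < 1 := by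
      intro z hz
      obtain ⟨v, hv0, hv⟩ := mem_spectrum_iff_exists_mulVec.1 hz
      by_contra hz1
      refine hv0 (h z v ?_ hv)
      have : (1 : NNReal) ≤ ‖z‖₊ := by exact_mod_cast not_lt.1 hz1
      exact this
    rcases (spectrum ℂ (M.map Complex.ofReal)).eq_empty_or_nonempty with he | hne
    -- An empty spectrum only arises from an empty index type; the supremum is then `0`. Otherwise
    -- it is attained, which keeps the inequality strict.
    · simp [SchurStable, spectralRadius, he]
    · obtain ⟨z, hz, hmax⟩ := Set.exists_max_image _ (fun z : ℂ => (‖z‖₊ : ENNReal)) hfin hne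
      exact (iSup₂_le hmax).trans_lt (hlt z hz)

lemma aeval_charpoly_ne_zero {M : Matrix ι ι ℝ} (hM : SchurStable M) (z : ℂ) (hz : 1 ≤ ‖z‖) :
    Polynomial.aeval z M.charpoly ≠ 0 := by
  have h1 : Polynomial.aeval z M.charpoly = (scalar ι z - M.map Complex.ofReal).det := by
    rw [← eval_charpoly]
    have := charpoly_map M (Complex.ofRealHom)
    rw [show M.map Complex.ofReal = M.map Complex.ofRealHom from rfl, this, Polynomial.eval_map]
    rfl
  rw [h1]
  intro h0
  obtain ⟨v, hv0, hv⟩ := exists_mulVec_eq_zero_iff.2 h0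
  refine hv0 (schurStable_iff.1 hM z v hz ?_)
  rw [sub_mulVec, sub_eq_zero, scalar_apply, ← smul_one_eq_diagonal, smul_mulVec,
    one_mulVec] at hv
  exact hv.symm

/-- The matrix `zI - A` over the rational functions. -/
def resolventInv (A : Matrix ι ι ℝ) : TransferMatrix ι ι :=
  Matrix.scalar ι (RatFunc.X : RatFunc ℝ) - constTM A

lemma resolventInv_eq_map (A : Matrix ι ι ℝ) :
    resolventInv A = A.charmatrix.map (algebraMap (Polynomial ℝ) (RatFunc ℝ)) := by
  ext i j
  by_cases h : i = j
  · subst h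
    simp [resolventInv, constTM]
  · simp [resolventInv, constTM, h]

lemma det_resolventInv (A : Matrix ι ι ℝ) :
    (resolventInv A).det = algebraMap (Polynomial ℝ) (RatFunc ℝ) A.charpoly := by
  rw [resolventInv_eq_map, charpoly, RingHom.map_det]
  rfl

lemma isUnit_det_resolventInv (A : Matrix ι ι ℝ) : IsUnit (resolventInv A).det := by
  rw [det_resolventInv, isUnit_iff_ne_zero]
  exact RatFunc.algebraMap_ne_zero A.charpoly_monic.ne_zero

lemma resolvent_apply (A : Matrix ι ι ℝ) (i j : ι) :
    (resolventInv A)⁻¹ i j = algebraMap (Polynomial ℝ) (RatFunc ℝ) (A.charmatrix.adjugate i j) /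
      algebraMap (Polynomial ℝ) (RatFunc ℝ) A.charpoly := by
  rw [inv_def, Ring.inverse_eq_inv', Matrix.smul_apply, smul_eq_mul, det_resolventInv,
    resolventInv_eq_map, div_eq_inv_mul]
  congr 1
  have := RingHom.map_adjugate (algebraMap (Polynomial ℝ) (RatFunc ℝ)) A.charmatrix
  exact (congrFun (congrFun this i) j).symm

/-- Writes an entry of the adjugate of `X - A` as a determinant `det (X M + N)` in which `M` has a
zero row. Its coefficient at the full degree is `det M = 0`, which makes the resolvent strictly
proper. -/
lemma updateRow_charmatrix (A : Matrix ι ι ℝ) (i j : ι) :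
    A.charmatrix.updateRow j (Pi.single i 1) =
      (Polynomial.X : Polynomial ℝ) • ((1 : Matrix ι ι ℝ).updateRow j 0).map Polynomial.C +
        ((-A).updateRow j (Pi.single i 1)).map Polynomial.C := by
  ext1 k l
  rw [Matrix.add_apply, Matrix.smul_apply, map_apply, map_apply, updateRow_apply, updateRow_apply,
    updateRow_apply]
  split_ifs with h
  · by_cases hl : l = i
    · subst hl; simp
    · simp [hl]
  · by_cases hl : k = l
    · subst hl; simp [sub_eq_add_neg]
    · simp [hl]

lemma natDegree_adjugate_charmatrix_le (A : Matrix ι ι ℝ) (i j : ι) :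
    (A.charmatrix.adjugate i j).natDegree ≤ Fintype.card ι := by
  rw [adjugate_apply, updateRow_charmatrix]
  exact Polynomial.natDegree_det_X_add_C_le _ _

lemma coeff_adjugate_charmatrix (A : Matrix ι ι ℝ) (i j : ι) :
    (A.charmatrix.adjugate i j).coeff (Fintype.card ι) = 0 := by
  rw [adjugate_apply, updateRow_charmatrix, Polynomial.coeff_det_X_add_C_card]
  exact det_eq_zero_of_row_eq_zero j fun k => by simp

lemma resolvent_num_denom (A : Matrix ι ι ℝ) (i j : ι) :
    ((resolventInv A)⁻¹ i j).num * A.charpoly =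
      A.charmatrix.adjugate i j * ((resolventInv A)⁻¹ i j).denom :=
  (RatFunc.num_mul_eq_mul_denom_iff A.charpoly_monic.ne_zero).2 (resolvent_apply A i j)

lemma inRHinf_resolvent {A : Matrix ι ι ℝ} (hA : SchurStable A) : InRHinf (resolventInv A)⁻¹ :=
  fun i j => .of_num_denom A.charpoly_monic.ne_zero (resolvent_num_denom A i j)
    (by rw [charpoly_natDegree_eq_dim]; exact natDegree_adjugate_charmatrix_le A i j)
    (aeval_charpoly_ne_zero hA)

/-- The resolvent is strictly proper. -/
lemma diskMat_resolvent_zero {A : Matrix ι ι ℝ} (hA : SchurStable A) :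
    diskMat (resolventInv A)⁻¹ 0 = 0 := by
  ext i j
  have hc : A.charpoly.coeff (Fintype.card ι) = 1 := by
    rw [← charpoly_natDegree_eq_dim A]
    exact A.charpoly_monic
  have h := diskEval_eq (inRHinf_resolvent hA i j) (resolvent_num_denom A i j)
    (natDegree_adjugate_charmatrix_le A i j) (charpoly_natDegree_eq_dim A).le (ζ := 0) (by simp)
    (by rw [aeval_reflect_zero, hc]; simp)
  rw [aeval_reflect_zero, coeff_adjugate_charmatrix] at h
  simpa [diskMat] using h

end Schur

/-! ### Stability and strict properness of the plant -/

section TransferMatrix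

variable {n m p : ℕ} {A : Matrix (Fin n) (Fin n) ℝ} {B : Matrix (Fin n) (Fin m) ℝ}
  {C : Matrix (Fin p) (Fin n) ℝ}

lemma transferMatrix_zero : transferMatrix A B C 0 = constTM C * (resolventInv A)⁻¹ * constTM B := by
  rw [transferMatrix, constTM_zero, add_zero]
  rfl

lemma inRHinf_transferMatrix (hA : SchurStable A) : InRHinf (transferMatrix A B C 0) := by
  rw [transferMatrix_zero]
  exact ((inRHinf_constTM C).mul (inRHinf_resolvent hA)).mul (inRHinf_constTM B)

lemma diskMat_transferMatrix_zero (hA : SchurStable A) :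
    diskMat (transferMatrix A B C 0) 0 = 0 := by
  have h0 : ‖(0 : ℂ)‖ ≤ 1 := by simp
  rw [transferMatrix_zero, diskMat_mul ((inRHinf_constTM C).mul (inRHinf_resolvent hA))
    (inRHinf_constTM B) h0, diskMat_mul (inRHinf_constTM C) (inRHinf_resolvent hA) h0,
    diskMat_resolvent_zero hA, Matrix.mul_zero, Matrix.zero_mul]

/-- A solution `V` of `(zI - A) V = B` gives the transfer matrix as `C V + D`. -/
lemma transferMatrix_eq {D : Matrix (Fin p) (Fin m) ℝ} {V : TransferMatrix (Fin n) (Fin m)}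
    (hV : resolventInv A * V = constTM B) : transferMatrix A B C D = constTM C * V + constTM D := by
  rw [transferMatrix, ← hV]
  change constTM C * (resolventInv A)⁻¹ * (resolventInv A * V) + _ = _
  rw [Matrix.mul_assoc, nonsing_inv_mul_cancel_left _ _ (isUnit_det_resolventInv A)]

end TransferMatrix

/-! ### State-space realization of stable transfer matrices -/

section Realization

open Polynomial

/-- The companion matrix of a polynomial in controllable canonical form. -/
def controllableCompanion (P : ℝ[X]) : Matrix (Fin P.natDegree) (Fin P.natDegree) ℝ :=
  fun i j => if (i : ℕ) + 1 = P.natDegree then -P.coeff j else if (i : ℕ) + 1 = j then 1 else 0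

/-- Stated over an `ℝ`-algebra since it is used twice: for complex eigenvectors and for the rational
vector `X ^ j / P`. -/
lemma sum_controllableCompanion {R : Type} [Ring R] [Algebra ℝ R] (P : ℝ[X])
    (i : Fin P.natDegree) (v : ℕ → R) :
    ∑ j, controllableCompanion P i j • v j =
      if (i : ℕ) + 1 = P.natDegree then -∑ j ∈ Finset.range P.natDegree, P.coeff j • v j
      else v (i + 1) := by
  split_ifs with h
  · rw [← Finset.sum_neg_distrib, Finset.sum_range]
    refine Finset.sum_congr rfl fun j _ => ?_
    simp [controllableCompanion, h]
  · have hi : (i : ℕ) + 1 < P.natDegree := lt_of_le_of_ne i.2 h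
    rw [Finset.sum_eq_single (⟨i + 1, hi⟩ : Fin P.natDegree)]
    · simp [controllableCompanion, h]
    · intro j _ hj
      have : (i : ℕ) + 1 ≠ j := fun hij => hj (Fin.ext hij.symm)
      simp [controllableCompanion, h, this]
    · simp

lemma algebraMap_eq_sum {N : ℝ[X]} {d : ℕ} (hN : N.natDegree ≤ d) :
    algebraMap ℝ[X] (RatFunc ℝ) N =
      ∑ j ∈ Finset.range d, N.coeff j • (RatFunc.X : RatFunc ℝ) ^ j +
        N.coeff d • (RatFunc.X : RatFunc ℝ) ^ d := by
  rw [← Finset.sum_range_succ]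
  conv_lhs => rw [N.as_sum_range_C_mul_X_pow' (Nat.lt_succ_of_le hN)]
  rw [map_sum]
  refine Finset.sum_congr rfl fun j _ => ?_
  rw [map_mul, map_pow, RatFunc.algebraMap_X, RatFunc.algebraMap_C, RatFunc.smul_eq_C_mul]

/-- The shift rows force `w j = z ^ j w 0`; the last row then reads `P(z) w 0 = 0`. -/
lemma eigenvector_controllableCompanion {P : ℝ[X]} (hP : P.Monic) {z : ℂ}
    (hz : aeval z P ≠ 0) (w : Fin P.natDegree → ℂ)
    (hw : ∀ i, ∑ j, controllableCompanion P i j • w j = z * w i) : w = 0 := by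
  let v : ℕ → ℂ := fun j => if h : j < P.natDegree then w ⟨j, h⟩ else 0
  have hv : ∀ j : Fin P.natDegree, v j = w j := fun j => by simp [v]
  have hw' : ∀ i : Fin P.natDegree, (if (i : ℕ) + 1 = P.natDegree then
      -∑ j ∈ Finset.range P.natDegree, P.coeff j • v j else v (i + 1)) = z * v i := by
    intro i
    rw [← sum_controllableCompanion, hv, ← hw i]
    simp only [hv]
  have hpow : ∀ k, k < P.natDegree → v k = z ^ k * v 0 := by
    intro k
    induction k with
    | zero => simp
    | succ k ih =>
      intro hk
      have h1 := hw' ⟨k, by omega⟩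
      rw [if_neg (by simp only; omega)] at h1
      simp only at h1
      rw [h1, ih (by omega)]
      ring
  ext i
  have hd : 0 < P.natDegree := i.pos
  have hlast := hw' ⟨P.natDegree - 1, by omega⟩
  rw [if_pos (by simp only; omega)] at hlast
  simp only at hlast
  have hsum : ∑ j ∈ Finset.range P.natDegree, P.coeff j • v j =
      (∑ j ∈ Finset.range P.natDegree, P.coeff j • z ^ j) * v 0 := by
    rw [Finset.sum_mul]
    refine Finset.sum_congr rfl fun j hj => ?_
    rw [hpow j (Finset.mem_range.1 hj), smul_mul_assoc]
  have hroot : aeval z P * v 0 = 0 := by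
    rw [aeval_eq_sum_range, Finset.sum_range_succ, hP.coeff_natDegree, one_smul, add_mul, ← hsum]
    rw [hpow _ (by omega), ← mul_assoc, ← pow_succ', Nat.sub_add_cancel hd] at hlast
    rw [← hlast]
    ring
  have h0 : v 0 = 0 := (mul_eq_zero.1 hroot).resolve_left hz
  rw [← hv i, hpow i i.2, h0, mul_zero]
  rfl

lemma exists_common_denom {τ : Type} [Fintype τ] {f : τ → RatFunc ℝ}
    (hf : ∀ i, IsProperStable (f i)) :
    ∃ P : ℝ[X], P.Monic ∧ (∀ z : ℂ, 1 ≤ ‖z‖ → aeval z P ≠ 0) ∧ ∃ N : τ → ℝ[X],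
      (∀ i, (N i).natDegree ≤ P.natDegree) ∧
      ∀ i, f i = algebraMap ℝ[X] (RatFunc ℝ) (N i) / algebraMap ℝ[X] (RatFunc ℝ) P := by
  obtain ⟨P, hmonic, hst, hdvd⟩ : ∃ P : ℝ[X], P.Monic ∧ (∀ z : ℂ, 1 ≤ ‖z‖ → aeval z P ≠ 0) ∧
      ∀ i, (f i).denom ∣ P := by
    refine ⟨∏ i, (f i).denom, monic_prod_of_monic _ _ fun i _ => RatFunc.monic_denom _,
      fun z hz => ?_, fun i => Finset.dvd_prod_of_mem _ (Finset.mem_univ i)⟩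
    rw [map_prod]
    exact Finset.prod_ne_zero_iff.2 fun i _ => (hf i).2 z hz
  refine ⟨P, hmonic, hst, ?_⟩
  choose E hE using fun i => exists_eq_mul_right_of_dvd (hdvd i)
  have hE0 : ∀ i, E i ≠ 0 := fun i h0 => by
    have := hE i
    rw [h0, mul_zero] at this
    exact hmonic.ne_zero this
  refine ⟨fun i => (f i).num * E i, fun i => ?_, fun i => ?_⟩
  · have hd := congrArg natDegree (hE i)
    rw [natDegree_mul (RatFunc.denom_ne_zero _) (hE0 i)] at hd
    rw [hd]
    exact natDegree_mul_le.trans (add_le_add (hf i).1 le_rfl)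
  · have hP := congrArg (algebraMap ℝ[X] (RatFunc ℝ)) (hE i)
    rw [map_mul] at hP
    rw [hP, map_mul, mul_div_mul_right _ _ (RatFunc.algebraMap_ne_zero (hE0 i)),
      RatFunc.num_div_denom]

lemma resolvent_controllableCompanion {P : ℝ[X]} (hP : P.Monic) (i : Fin P.natDegree) :
    RatFunc.X * ((RatFunc.X : RatFunc ℝ) ^ (i : ℕ) / algebraMap ℝ[X] (RatFunc ℝ) P) -
      ∑ j : Fin P.natDegree, RatFunc.C (controllableCompanion P i j) *
        ((RatFunc.X : RatFunc ℝ) ^ (j : ℕ) / algebraMap ℝ[X] (RatFunc ℝ) P) =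
      if (i : ℕ) + 1 = P.natDegree then 1 else 0 := by
  have hP0 : algebraMap ℝ[X] (RatFunc ℝ) P ≠ 0 := RatFunc.algebraMap_ne_zero hP.ne_zero
  have h := sum_controllableCompanion P i fun j =>
    (RatFunc.X : RatFunc ℝ) ^ j / algebraMap ℝ[X] (RatFunc ℝ) P
  simp only [RatFunc.smul_eq_C_mul] at h
  rw [h]
  split_ifs with hi
  · rw [sub_neg_eq_add, ← mul_div_assoc, ← pow_succ', hi]
    simp only [← mul_div_assoc, ← Finset.sum_div, ← RatFunc.smul_eq_C_mul]
    rw [← add_div, div_eq_one_iff_eq hP0, algebraMap_eq_sum (le_refl P.natDegree),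
      hP.coeff_natDegree, one_smul, add_comm]
  · ring

/-- Every stable transfer matrix has a state-space realization `(A, B, C, D)` with a Schur stable
matrix `A`; here `V = (zI - A)⁻¹ B`. -/
lemma exists_realization {m p : ℕ} {Q : TransferMatrix (Fin m) (Fin p)} (hQ : InRHinf Q) :
    ∃ (d : ℕ) (A : Matrix (Fin d × Fin p) (Fin d × Fin p) ℝ) (B : Matrix (Fin d × Fin p) (Fin p) ℝ)
      (C : Matrix (Fin m) (Fin d × Fin p) ℝ) (D : Matrix (Fin m) (Fin p) ℝ)
      (V : TransferMatrix (Fin d × Fin p) (Fin p)), SchurStable A ∧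
      resolventInv A * V = constTM B ∧ constTM C * V + constTM D = Q := by
  obtain ⟨P, hP, hst, N', hdeg', hN'⟩ :=
    exists_common_denom (f := fun ij : Fin m × Fin p => Q ij.1 ij.2) fun ij => hQ ij.1 ij.2
  obtain ⟨N, hdeg, hN⟩ : ∃ N : Fin m → Fin p → ℝ[X],
      (∀ i j, (N i j).natDegree ≤ P.natDegree) ∧ ∀ i j, Q i j =
        algebraMap ℝ[X] (RatFunc ℝ) (N i j) / algebraMap ℝ[X] (RatFunc ℝ) P :=
    ⟨fun i j => N' (i, j), fun i j => hdeg' (i, j), fun i j => hN' (i, j)⟩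
  have hP0 : algebraMap ℝ[X] (RatFunc ℝ) P ≠ 0 := RatFunc.algebraMap_ne_zero hP.ne_zero
  -- Controllable canonical form with one companion block per input. `D` collects the values at
  -- infinity, `C` the coefficients of the numerators minus `D P`, and `V` has the entries `X ^ i /
  -- P`.
  refine ⟨P.natDegree, blockDiagonal fun _ => controllableCompanion P,
    Matrix.of fun ik l => if ik.2 = l then if (ik.1 : ℕ) + 1 = P.natDegree then 1 else 0 else 0,
    Matrix.of fun i jl =>
      (N i jl.2).coeff jl.1 - (N i jl.2).coeff P.natDegree * P.coeff jl.1,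
    Matrix.of fun i l => (N i l).coeff P.natDegree,
    Matrix.of fun ik l => if ik.2 = l then RatFunc.X ^ (ik.1 : ℕ) / algebraMap _ _ P else 0,
    ?_, ?_, ?_⟩
  · rw [schurStable_iff]
    intro z w hz hw
    ext ⟨i, k⟩
    have h := eigenvector_controllableCompanion hP (hst z hz) (fun i => w (i, k)) fun i => by
      have := congrFun hw (i, k)
      rw [mulVec, dotProduct, Fintype.sum_prod_type] at this
      simpa [blockDiagonal_apply, apply_ite Complex.ofReal, ite_mul] using this
    exact congrFun h i
  · ext1 ⟨i, k⟩ l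
    have h := resolvent_controllableCompanion hP i
    rw [resolventInv, Matrix.sub_mul, scalar_apply, Matrix.sub_apply, diagonal_mul, mul_apply,
      Fintype.sum_prod_type]
    by_cases hkl : k = l
    · subst hkl
      simpa [constTM, blockDiagonal_apply, apply_ite RatFunc.C, ite_mul] using h
    · simp [constTM, blockDiagonal_apply, hkl, apply_ite RatFunc.C, ite_mul]
  · ext1 i l
    rw [Matrix.add_apply, mul_apply, Fintype.sum_prod_type, hN, eq_div_iff hP0,
      algebraMap_eq_sum (hdeg i l)]
    simp only [constTM, map_apply, of_apply, mul_ite, mul_zero, Finset.sum_ite_eq',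
      Finset.mem_univ, if_true, ← mul_div_assoc, ← Finset.sum_div]
    rw [add_mul, div_mul_cancel₀ _ hP0, algebraMap_eq_sum (le_refl P.natDegree),
      hP.coeff_natDegree, one_smul, Finset.sum_range, Finset.sum_range, mul_add, Finset.mul_sum,
      ← add_assoc, ← Finset.sum_add_distrib, RatFunc.smul_eq_C_mul]
    congr 1
    refine Finset.sum_congr rfl fun j _ => ?_
    rw [RatFunc.smul_eq_C_mul, RatFunc.smul_eq_C_mul, map_sub, map_mul]
    ring

end Realization

/-! ### Constant transfer matrices and block resolvents -/

section ConstTM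

variable {ι κ τ ι' κ' : Type}

lemma constTM_mul [Fintype κ] (M : Matrix ι κ ℝ) (N : Matrix κ τ ℝ) :
    constTM (M * N) = constTM M * constTM N := Matrix.map_mul (f := RatFunc.C)

lemma constTM_add (M N : Matrix ι κ ℝ) : constTM (M + N) = constTM M + constTM N :=
  Matrix.map_add _ (fun a b => map_add RatFunc.C a b) M N

lemma constTM_sub (M N : Matrix ι κ ℝ) : constTM (M - N) = constTM M - constTM N :=
  Matrix.map_sub _ (fun a b => map_sub RatFunc.C a b) M N

lemma constTM_neg (M : Matrix ι κ ℝ) : constTM (-M) = -constTM M :=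
  Matrix.map_neg _ (fun a => map_neg RatFunc.C a) M

lemma constTM_fromRows (M : Matrix ι κ ℝ) (N : Matrix ι' κ ℝ) :
    constTM (fromRows M N) = fromRows (constTM M) (constTM N) := by
  ext (i | i) j <;> rfl

lemma constTM_fromCols (M : Matrix ι κ ℝ) (N : Matrix ι κ' ℝ) :
    constTM (fromCols M N) = fromCols (constTM M) (constTM N) := by
  ext i (j | j) <;> rfl

variable [Fintype ι] [DecidableEq ι] [Fintype ι'] [DecidableEq ι']

lemma resolventInv_fromBlocks (M : Matrix ι ι ℝ) (N : Matrix ι ι' ℝ) (P : Matrix ι' ι ℝ)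
    (Q : Matrix ι' ι' ℝ) : resolventInv (fromBlocks M N P Q) =
      fromBlocks (resolventInv M) (-constTM N) (-constTM P) (resolventInv Q) := by
  rw [resolventInv, constTM, fromBlocks_map]
  ext (i | i) (j | j) <;> simp [resolventInv, constTM, diagonal_apply]

lemma resolventInv_submatrix (M : Matrix ι ι ℝ) (e : ι' ≃ ι) :
    resolventInv (M.submatrix e e) = (resolventInv M).submatrix e e := by
  ext i j
  simp [resolventInv, constTM, diagonal_apply]

lemma schurStable_submatrix {M : Matrix ι ι ℝ} (hM : SchurStable M) (e : ι' ≃ ι) :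
    SchurStable (M.submatrix e e) := by
  rw [schurStable_iff] at hM ⊢
  intro z v hz hv
  have h := hM z (v ∘ e.symm) hz ?_
  · ext i
    simpa using congrFun h (e i)
  · ext i
    have := congrFun hv (e.symm i)
    simp only [mulVec, dotProduct, map_apply, submatrix_apply, Equiv.apply_symm_apply] at this
    rw [mulVec, dotProduct, ← e.sum_comp]
    simpa using this

end ConstTM

/-! ### Closed-loop responses -/

section ClosedLoop

variable {m p : ℕ}

/-- The closed-loop responses in terms of the response `U = K (1 - G K)⁻¹`. -/
lemma closedLoop_eq {G : TransferMatrix (Fin p) (Fin m)} {K U : TransferMatrix (Fin m) (Fin p)}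
    (h : U = K * (1 + G * U)) :
    (1 - G * K) * (1 + G * U) = 1 ∧
      closedLoop G K = ⟨1 + G * U, U, (1 + G * U) * G, 1 + U * G⟩ := by
  have h1 : (1 - G * K) * (1 + G * U) = 1 := by
    rw [Matrix.sub_mul, Matrix.one_mul, Matrix.mul_assoc, ← h, add_sub_cancel_right]
  have h2 : (1 - K * G) * (1 + U * G) = 1 := by
    have h3 : K * G * (1 + U * G) = K * (1 + G * U) * G := by
      simp only [Matrix.mul_add, Matrix.add_mul, Matrix.mul_one, Matrix.mul_assoc]
    rw [Matrix.sub_mul, Matrix.one_mul, h3, ← h, add_sub_cancel_right]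
  refine ⟨h1, ?_⟩
  simp only [closedLoop, inv_eq_right_inv h1, inv_eq_right_inv h2, ← h]

variable {n : ℕ} {A : Matrix (Fin n) (Fin n) ℝ} {B : Matrix (Fin n) (Fin m) ℝ}
  {C : Matrix (Fin p) (Fin n) ℝ}

/-- The closed-loop response `U` of an internally stabilizing controller is stable. -/
lemma exists_stable_response {q : ℕ} (κ : Controller q m p)
    (hκ : SchurStable (closedLoopMatrix A B C κ)) :
    ∃ U : TransferMatrix (Fin m) (Fin p), InRHinf U ∧ U = κ.tf * (1 + transferMatrix A B C 0 * U) := by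
  -- `X` is the response of the joint plant and controller state to `v`, and `U` below is the
  -- resulting input. Both are stable because only the resolvent of the closed-loop matrix enters;
  -- no minimality of the realization is needed.
  set X := (resolventInv (closedLoopMatrix A B C κ))⁻¹ *
    constTM (fromRows (B * κ.Dk) κ.Bk) with hX
  have hRX : resolventInv (closedLoopMatrix A B C κ) * X = constTM (fromRows (B * κ.Dk) κ.Bk) := by
    rw [hX, mul_nonsing_inv_cancel_left _ _ (isUnit_det_resolventInv _)]
  have hXst : InRHinf X := (inRHinf_resolvent hκ).mul (inRHinf_constTM _)
  obtain ⟨X₁, X₂, hX12⟩ : ∃ X₁ X₂, X = fromRows X₁ X₂ := ⟨_, _, (fromRows_toRows X).symm⟩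
  set U := constTM (fromCols (κ.Dk * C) κ.Ck) * X + constTM κ.Dk with hU
  have hUst : InRHinf U := ((inRHinf_constTM _).mul hXst).add (inRHinf_constTM _)
  refine ⟨U, hUst, ?_⟩
  rw [hX12, constTM_fromCols, fromCols_mul_fromRows, constTM_mul] at hU
  rw [hX12, closedLoopMatrix, resolventInv_fromBlocks, fromBlocks_mul_fromRows, constTM_fromRows,
    fromRows_inj.eq_iff] at hRX
  obtain ⟨e1, e2⟩ := hRX
  -- The upper block row becomes the plant equation once `U` is recognized in it; the lower one
  -- becomes the controller equation `e2'`.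
  have e1' : resolventInv A * X₁ = constTM B * U := by
    have : resolventInv (A + B * κ.Dk * C) = resolventInv A - constTM B * constTM κ.Dk * constTM C
        := by
      rw [resolventInv, resolventInv, constTM_add, constTM_mul, constTM_mul]
      abel
    rw [this, constTM_mul, constTM_mul, Matrix.sub_mul, Matrix.neg_mul] at e1
    rw [hU, Matrix.mul_add, Matrix.mul_add, ← e1]
    simp only [Matrix.mul_assoc]
    abel
  have hCX : constTM C * X₁ = transferMatrix A B C 0 * U := by
    rw [transferMatrix_zero, Matrix.mul_assoc, Matrix.mul_assoc, ← e1',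
      nonsing_inv_mul_cancel_left _ _ (isUnit_det_resolventInv A)]
  have e2' : resolventInv κ.Ak * X₂ = constTM κ.Bk * (1 + transferMatrix A B C 0 * U) := by
    rw [constTM_mul, Matrix.neg_mul, Matrix.mul_assoc, hCX] at e2
    rw [Matrix.mul_add, Matrix.mul_one, add_comm, ← neg_add_eq_iff_eq_add]
    exact e2
  have hCk : constTM κ.Ck * X₂ + constTM κ.Dk * (1 + transferMatrix A B C 0 * U) =
      κ.tf * (1 + transferMatrix A B C 0 * U) := by
    have : κ.tf = constTM κ.Ck * (resolventInv κ.Ak)⁻¹ * constTM κ.Bk + constTM κ.Dk := rfl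
    rw [this, Matrix.add_mul, Matrix.mul_assoc, Matrix.mul_assoc, ← e2',
      nonsing_inv_mul_cancel_left _ _ (isUnit_det_resolventInv κ.Ak)]
  refine Eq.trans ?_ hCk
  rw [Matrix.mul_add, Matrix.mul_one, ← hCX]
  refine hU.trans ?_
  rw [Matrix.mul_assoc]
  abel

/-- The Youla parametrization for a stable plant: if `K = Q (1 - G K)` with a stable `Q`, then `K`
internally stabilizes `G`. -/
lemma internallyStabilizes_of_youla (hA : SchurStable A) {Q K : TransferMatrix (Fin m) (Fin p)}
    (hQ : InRHinf Q) (hK : K = Q * (1 - transferMatrix A B C 0 * K)) :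
    InternallyStabilizes A B C K := by
  obtain ⟨d, Aq, Bq, Cq, Dq, V, hAq, hV, hQV⟩ := exists_realization hQ
  set G := transferMatrix A B C 0 with hG
  set e := (Fintype.equivFin (Fin n ⊕ Fin d × Fin p)).symm with he
  -- Internal model control: the controller runs a copy of the plant, with state `ξ`, and feeds the
  -- innovation `y - C ξ` to the realization of `Q`.
  set Ak := fromBlocks (A - B * Dq * C) (B * Cq) (-(Bq * C)) Aq with hAk
  set Bk := fromRows (B * Dq) Bq with hBk
  set Ck := fromCols (-(Dq * C)) Cq with hCk
  refine ⟨_, ⟨Ak.submatrix e e, Bk.submatrix e id, Ck.submatrix id e, Dq⟩, ?_, ?_⟩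
  · set X := (resolventInv A)⁻¹ * (constTM B * K) with hX
    have hRX : resolventInv A * X = constTM B * K := by
      rw [hX, mul_nonsing_inv_cancel_left _ _ (isUnit_det_resolventInv _)]
    have hCX : constTM C * X = G * K := by
      rw [hX, hG, transferMatrix_zero]
      simp only [Matrix.mul_assoc]
    set E := 1 - G * K with hE
    have hCV : constTM Cq * V = Q - constTM Dq := by rw [← hQV, add_sub_cancel_right]
    -- The copy of the plant responds to `y` by `X`. The realization of `Q` sees `E y` with `E = 1 -
    -- G K`, so its state is `V E`.
    rw [Controller.tf, transferMatrix_eq (V := (fromRows X (V * E)).submatrix e id)]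
    · have : constTM (Ck.submatrix id e) = (constTM Ck).submatrix id e := rfl
      rw [this, submatrix_mul_equiv, hCk, constTM_fromCols, fromCols_mul_fromRows, submatrix_id_id,
        constTM_neg, constTM_mul, Matrix.neg_mul, Matrix.mul_assoc, hCX,
        ← Matrix.mul_assoc (constTM Cq), hCV, Matrix.sub_mul, ← hK, hE, Matrix.mul_sub,
        Matrix.mul_one]
      abel
    · have : constTM (Bk.submatrix e id) = (constTM Bk).submatrix e id := rfl
      rw [this, resolventInv_submatrix, submatrix_mul_equiv]
      congr 1
      rw [hAk, hBk, resolventInv_fromBlocks, fromBlocks_mul_fromRows, constTM_fromRows]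
      congr 1
      · have : resolventInv (A - B * Dq * C) =
            resolventInv A + constTM B * constTM Dq * constTM C := by
          rw [resolventInv, resolventInv, constTM_sub, constTM_mul, constTM_mul]
          abel
        rw [this, constTM_mul, constTM_mul, Matrix.add_mul, hRX, Matrix.mul_assoc _ (constTM C),
          hCX, Matrix.neg_mul, Matrix.mul_assoc _ (constTM Cq), ← Matrix.mul_assoc (constTM Cq),
          hCV, Matrix.sub_mul, ← hK, hE]
        simp only [Matrix.mul_sub, Matrix.mul_one, Matrix.mul_assoc]
        abel
      · rw [constTM_neg, neg_neg, constTM_mul, Matrix.mul_assoc, hCX,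
          ← Matrix.mul_assoc (resolventInv Aq), hV, hE, Matrix.mul_sub, Matrix.mul_one]
        abel
  · set M := fromBlocks (A + B * Dq * C) (B * Ck) (Bk * C) Ak with hM
    have hcl : closedLoopMatrix A B C ⟨Ak.submatrix e e, Bk.submatrix e id, Ck.submatrix id e, Dq⟩ =
        M.submatrix ((Equiv.refl (Fin n)).sumCongr e) ((Equiv.refl (Fin n)).sumCongr e) := by
      ext (i | i) (j | j) <;> rfl
    rw [hcl]
    refine schurStable_submatrix ?_ _
    rw [schurStable_iff]
    intro z v hz hv
    obtain ⟨x, y, w, rfl⟩ : ∃ x y w, v = Sum.elim x (Sum.elim y w) := by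
      refine ⟨v ∘ Sum.inl, v ∘ Sum.inr ∘ Sum.inl, v ∘ Sum.inr ∘ Sum.inr, ?_⟩
      ext (i | i | i) <;> rfl
    have hmul : ∀ {r s t : Type} [Fintype s] (P : Matrix r s ℝ) (Q : Matrix s t ℝ),
        (P * Q).map Complex.ofReal = P.map Complex.ofReal * Q.map Complex.ofReal := fun P Q =>
      Matrix.map_mul (f := Complex.ofRealHom)
    have hadd : ∀ {r s : Type} (P Q : Matrix r s ℝ),
        (P + Q).map Complex.ofReal = P.map Complex.ofReal + Q.map Complex.ofReal := fun P Q =>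
      Matrix.map_add _ Complex.ofReal_add P Q
    have hsub : ∀ {r s : Type} (P Q : Matrix r s ℝ),
        (P - Q).map Complex.ofReal = P.map Complex.ofReal - Q.map Complex.ofReal := fun P Q =>
      Matrix.map_sub _ Complex.ofReal_sub P Q
    have hneg : ∀ {r s : Type} (P : Matrix r s ℝ),
        (-P).map Complex.ofReal = -P.map Complex.ofReal := fun P =>
      Matrix.map_neg _ Complex.ofReal_neg P
    have hz_smul : z • Sum.elim x (Sum.elim y w) = Sum.elim (z • x) (Sum.elim (z • y) (z • w)) := by
      ext (i | i | i) <;> rfl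
    rw [hM, hCk, hBk, hAk, mul_fromCols, fromRows_mul, fromBlocks_map, fromBlocks_map,
      fromCols_map, fromRows_map, fromBlocks_mulVec, hz_smul, Sum.elim_comp_inl, Sum.elim_comp_inr,
      fromCols_mulVec_sumElim, fromRows_mulVec, fromBlocks_mulVec, Sum.elim_comp_inl,
      Sum.elim_comp_inr, ← Sum.elim_add_add] at hv
    simp only [Sum.elim_eq_iff, hmul, hadd, hsub, hneg, Matrix.mul_neg, neg_mulVec, add_mulVec,
      sub_mulVec] at hv
    obtain ⟨h1, h2, h3⟩ := hv
    rw [schurStable_iff] at hA hAq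
    -- The closed loop is block triangular: the mismatch `x - y` evolves by `A`; without mismatch
    -- `w` evolves by `Aq`, and then `x` by `A` again.
    have hxy : x = y := by
      refine sub_eq_zero.1 (hA z (x - y) hz ?_)
      rw [mulVec_sub, smul_sub, ← h1, ← h2, Matrix.mul_assoc]
      abel
    subst hxy
    have hw : w = 0 := by
      refine hAq z w hz ?_
      rw [← h3]
      abel
    subst hw
    have hx : x = 0 := by
      refine hA z x hz ?_
      rw [← h2, mulVec_zero]
      abel
    subst hx
    ext (i | i | i) <;> rfl

end ClosedLoop

/-! ### Pointwise perturbation bounds -/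

section Pointwise

variable {ι κ τ : Type} [Fintype ι] [Fintype κ] [Fintype τ]

lemma frob_le_of_eq_add_mul [DecidableEq κ] {X X₀ : Matrix ι κ ℂ} {P : Matrix κ κ ℂ} {c : ℝ}
    (hP : sigmaMax P ≤ c)
    (h : X = X₀ + X * P) : (1 - c) * frob X ≤ frob X₀ := by
  have h1 := frob_add_le X₀ (X * P)
  rw [← h] at h1
  have h2 := (frob_mul_le' X P).trans (mul_le_mul_of_nonneg_left hP (frob_nonneg X))
  linarith

lemma frob_le_of_eq_add_mul' [DecidableEq ι] {X X₀ : Matrix ι κ ℂ} {P : Matrix ι ι ℂ} {c : ℝ}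
    (hP : sigmaMax P ≤ c)
    (h : X = X₀ + P * X) : (1 - c) * frob X ≤ frob X₀ := by
  have h1 := frob_add_le X₀ (P * X)
  rw [← h] at h1
  have h2 := (frob_mul_le P X).trans (mul_le_mul_of_nonneg_right hP (frob_nonneg X))
  linarith

lemma sigmaMax_mul_le_mul [DecidableEq κ] [DecidableEq τ] {M : Matrix ι κ ℂ} {N : Matrix κ τ ℂ}
    {a b : ℝ} (hM : sigmaMax M ≤ a)
    (hN : sigmaMax N ≤ b) : sigmaMax (M * N) ≤ a * b :=
  (sigmaMax_mul_le M N).trans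
    (mul_le_mul hM hN (sigmaMax_nonneg N) ((sigmaMax_nonneg M).trans hM))

lemma frob_mul_le_mul [DecidableEq κ] [DecidableEq τ] {M : Matrix ι κ ℂ} {N : Matrix κ τ ℂ} {b : ℝ}
    (hN : sigmaMax N ≤ b) :
    frob (M * N) ≤ frob M * b :=
  (frob_mul_le' M N).trans (mul_le_mul_of_nonneg_left hN (frob_nonneg M))

lemma perturbationFactor_nonneg {Γ ε a : ℝ} (hΓ : 0 ≤ Γ) (hε : 0 ≤ ε) (ha : 0 ≤ a) :
    0 ≤ perturbationFactor Γ ε a := by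
  unfold perturbationFactor
  positivity

/-- In `h1` the term `-ε v w` is kept: `w (yΓ - w) ≤ (yΓ)²/4` is what yields `εΓ(2 + aΓ)` in `h`.
Bounding `w` by `yΓ` at once would give `2εΓ(1 + aΓ)`. -/
lemma scalar_plant_response {y w t Γ ε v a : ℝ} (hy : 0 ≤ y) (hw : 0 ≤ w) (ht : 0 ≤ t)
    (hΓ : 0 ≤ Γ) (hε : 0 ≤ ε) (hv : 0 ≤ v) (hva : v ≤ a) (hc : ε * v < 1) (hwy : w ≤ y * Γ)
    (h : (1 - ε * v) * t ≤ (1 - ε * v) * w + y * (ε * (1 + v * Γ))) :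
    (1 - ε * v) ^ 2 * t ^ 2 ≤ w ^ 2 + perturbationFactor Γ ε a * y ^ 2 := by
  have hz : 0 ≤ y * Γ - w := by linarith
  have h1 : (1 - ε * v) * t ≤ w + ε * (y + v * (y * Γ - w)) := by linarith
  have h2 : ((1 - ε * v) * t) ^ 2 ≤ (w + ε * (y + v * (y * Γ - w))) ^ 2 :=
    pow_le_pow_left₀ (mul_nonneg (by linarith) ht) h1 2
  have h3 : w * (y + v * (y * Γ - w)) ≤ y * Γ * y + v * (y * Γ) ^ 2 / 2 := by
    have e1 : 0 ≤ v * (w - (y * Γ - w)) ^ 2 := by positivity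
    have e2 : 0 ≤ (y * Γ - w) * y := by positivity
    have e3 : 0 ≤ v * (y * Γ) ^ 2 := by positivity
    nlinarith
  have h4 : (y + v * (y * Γ - w)) ^ 2 ≤ (y * (2 + a * Γ)) ^ 2 := by
    refine pow_le_pow_left₀ (by positivity) ?_ 2
    have e1 : 0 ≤ v * w := by positivity
    have e2 : v * (y * Γ) ≤ a * (y * Γ) := by gcongr
    nlinarith
  have h5 : v * (y * Γ) ^ 2 ≤ a * (y * Γ) ^ 2 := by gcongr
  have h6 := mul_le_mul_of_nonneg_left h3 hε
  have h7 := mul_le_mul_of_nonneg_left h4 (sq_nonneg ε)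
  have h8 := mul_le_mul_of_nonneg_left h5 hε
  unfold perturbationFactor
  linarith

/-- The weight `10` in `2wb ≤ 10w² + b²/10` keeps the loss on `w²` at `10x`, within the allowed
`20x`, and makes the coefficient of `γ² m` small. -/
lemma scalar_estimated_response {y w b Γ γ ε x m : ℝ} (hy : 0 ≤ y) (hε : 0 ≤ ε)
    (hx : 0 ≤ x) (hwy : w ≤ y * Γ) (hb2 : b ^ 2 ≤ γ ^ 2 * m) :
    (w + y * ε + x * b) ^ 2 ≤ (1 + 10 * x) * w ^ 2 + (2 * ε * Γ + 2 * ε ^ 2) * y ^ 2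
      + (x / 10 + 2 * x ^ 2) * (γ ^ 2 * m) := by
  have h1 : 0 ≤ x * (10 * w - b) ^ 2 := by positivity
  have h2 : 0 ≤ (y * ε - x * b) ^ 2 := sq_nonneg _
  have h3 : w * (y * ε) ≤ y * Γ * (y * ε) := by gcongr
  have h4 : (x / 10 + 2 * x ^ 2) * b ^ 2 ≤ (x / 10 + 2 * x ^ 2) * (γ ^ 2 * m) := by gcongr
  linarith

lemma scalar_identity_response {y b x m : ℝ} (hx : 0 ≤ x) (hb2 : b ^ 2 ≤ m) :
    (y + x * b) ^ 2 ≤ (1 + x) * (y ^ 2 + x * m) := by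
  have h1 : 0 ≤ x * (y - b) ^ 2 := by positivity
  have h2 : x * (1 + x) * b ^ 2 ≤ x * (1 + x) * m := by gcongr
  linarith

end Pointwise

/-! ### Comparison of `H_2` norms -/

section Comparison

variable {ι κ ι' κ' : Type} [Fintype ι] [Fintype κ] [Fintype ι'] [Fintype κ']

lemma h2Sq_le_of_frob_le {X : TransferMatrix ι κ} {X₀ : TransferMatrix ι' κ'} (hX : InRHinf X)
    (hX₀ : InRHinf X₀) {k : ℝ} (hk : 0 ≤ k)
    (h : ∀ ω, k * frob (freqResponse X ω) ≤ frob (freqResponse X₀ ω)) :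
    k ^ 2 * h2Sq X ≤ h2Sq X₀ := by
  rw [h2Sq, h2Sq, ← freqMean_const_mul]
  refine freqMean_mono ((continuous_frob_sq hX).const_mul _) (continuous_frob_sq hX₀) fun ω => ?_
  rw [← mul_pow]
  exact pow_le_pow_left₀ (mul_nonneg hk (frob_nonneg _)) (h ω) 2

lemma h2Sq_le_const {X : TransferMatrix ι κ} (hX : InRHinf X) {c : ℝ}
    (h : ∀ ω, frob (freqResponse X ω) ^ 2 ≤ c) : h2Sq X ≤ c :=
  (freqMean_mono (continuous_frob_sq hX) continuous_const h).trans_eq (freqMean_const c)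

lemma h2Sq_le_affine {ι'' κ'' : Type} [Fintype ι''] [Fintype κ''] {X : TransferMatrix ι κ}
    {Y : TransferMatrix ι' κ'} {W : TransferMatrix ι'' κ''} (hX : InRHinf X) (hY : InRHinf Y)
    (hW : InRHinf W) {k a b c : ℝ}
    (h : ∀ ω, k * frob (freqResponse X ω) ^ 2 ≤ a * frob (freqResponse W ω) ^ 2 +
      b * frob (freqResponse Y ω) ^ 2 + c) :
    k * h2Sq X ≤ a * h2Sq W + b * h2Sq Y + c := by
  have hX' := continuous_frob_sq hX
  have hY' := continuous_frob_sq hY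
  have hW' := continuous_frob_sq hW
  have h1 := freqMean_mono (hX'.const_mul k) (g := fun ω => a * frob (freqResponse W ω) ^ 2 +
      b * frob (freqResponse Y ω) ^ 2 + c) (by fun_prop) h
  rw [freqMean_const_mul, freqMean_add (by fun_prop) (by fun_prop),
    freqMean_add (by fun_prop) (by fun_prop), freqMean_const_mul, freqMean_const_mul,
    freqMean_const] at h1
  exact h1

end Comparison

/-! ### The feasible set and the objective -/

section Feasible

variable {m p : ℕ}

/-- The responses of the plant `G` with the Youla parameter `U`. -/
def youla (G : TransferMatrix (Fin p) (Fin m)) (U : TransferMatrix (Fin m) (Fin p)) :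
    Responses m p where
  Y := 1 + G * U
  U := U
  W := (1 + G * U) * G
  Z := 1 + U * G

/-- The constraints can be solved successively for `Y`, `W` and `Z`, so `U` is the only free
parameter. -/
lemma IsFeasible.eq_youla {Ghat : TransferMatrix (Fin p) (Fin m)} {ε α γ : ℝ} {Φ : Responses m p}
    (h : IsFeasible Ghat ε α γ Φ) : Φ = youla Ghat Φ.U := by
  have h1 := h.affine_left
  have h2 := h.affine_right
  rw [Responses.block, fromCols_mul_fromBlocks, fromCols_inj.eq_iff] at h1
  rw [Responses.block, fromBlocks_mul_fromRows, fromRows_inj.eq_iff] at h2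
  have hY : Φ.Y = 1 + Ghat * Φ.U := by
    have := h1.1
    rw [Matrix.one_mul, Matrix.neg_mul, ← sub_eq_add_neg, sub_eq_iff_eq_add] at this
    exact this
  have hW : Φ.W = Φ.Y * Ghat := by
    have := h2.1
    rwa [Matrix.mul_one, Matrix.mul_neg, neg_add_eq_zero, eq_comm] at this
  have hZ : Φ.Z = 1 + Φ.U * Ghat := by
    have := h2.2
    rwa [Matrix.mul_one, Matrix.mul_neg, neg_add_eq_iff_eq_add, add_comm] at this
  rw [hY] at hW
  rcases Φ with ⟨Y, U, W, Z⟩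
  simp only at hY hW hZ
  simp only [youla, hY, hW, hZ]

lemma isFeasible_youla {Ghat : TransferMatrix (Fin p) (Fin m)} {U : TransferMatrix (Fin m) (Fin p)}
    (hG : InRHinf Ghat) (hU : InRHinf U) {ε α γ : ℝ} (h0 : 0 ≤ γ) (h1 : γ < 1 / ε)
    (h2 : hinfNorm U ≤ min γ α) : IsFeasible Ghat ε α γ (youla Ghat U) where
  gamma_nonneg := h0
  gamma_lt := h1
  affine_left := by
    rw [Responses.block, fromCols_mul_fromBlocks]
    simp only [youla, Matrix.one_mul, Matrix.neg_mul]
    congr 1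
    · abel
    · rw [Matrix.add_mul, Matrix.mul_add, Matrix.one_mul, Matrix.mul_one, Matrix.mul_assoc]
      abel
  affine_right := by
    rw [Responses.block, fromBlocks_mul_fromRows]
    simp only [youla, Matrix.mul_one, Matrix.mul_neg]
    congr 1
    · abel
    · abel
  stable_Y := inRHinf_one.add (hG.mul hU)
  stable_U := hU
  stable_W := (inRHinf_one.add (hG.mul hU)).mul hG
  stable_Z := inRHinf_one.add (hU.mul hG)
  norm_U_le := h2

lemma objective_nonneg {Ghat : TransferMatrix (Fin p) (Fin m)} {ε α γ : ℝ} {Φ : Responses m p}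
    (hγ : ε * γ < 1) : 0 ≤ objective Ghat ε α γ Φ :=
  mul_nonneg (one_div_nonneg.2 (by linarith)) (h2Norm_nonneg _)

lemma objective_sq {Ghat : TransferMatrix (Fin p) (Fin m)} {ε α γ : ℝ} {Φ : Responses m p}
    (hε : 0 ≤ ε) (hα : 0 ≤ α) (hΦ : IsFeasible Ghat ε α γ Φ) (hγ : ε * γ < 1) :
    (1 - ε * γ) ^ 2 * objective Ghat ε α γ Φ ^ 2 =
      (1 + perturbationFactor (hinfNorm Ghat) ε α) * h2Sq Φ.Y + h2Sq Φ.W + h2Sq Φ.U + h2Sq Φ.Z := by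
  have h0 : 1 - ε * γ ≠ 0 := by linarith
  have hh := perturbationFactor_nonneg (hinfNorm_nonneg Ghat) hε hα
  rw [objective, mul_pow, h2Norm_sq, h2Sq_fromBlocks (hΦ.stable_Y.smul _) hΦ.stable_W hΦ.stable_U
    hΦ.stable_Z, h2Sq_smul hΦ.stable_Y, Real.sq_sqrt (by linarith), ← mul_assoc, ← mul_pow,
    mul_one_div_cancel h0, one_pow, one_mul]

lemma lqgJ_sq {G : TransferMatrix (Fin p) (Fin m)} {K U : TransferMatrix (Fin m) (Fin p)}
    (hG : InRHinf G) (hU : InRHinf U) (h : closedLoop G K = youla G U) :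
    lqgJ G K ^ 2 = h2Sq (1 + G * U) + h2Sq ((1 + G * U) * G) + h2Sq U + h2Sq (1 + U * G) := by
  rw [lqgJ, h2Norm_sq, h, Responses.block]
  exact h2Sq_fromBlocks (inRHinf_one.add (hG.mul hU)) ((inRHinf_one.add (hG.mul hU)).mul hG) hU
    (inRHinf_one.add (hU.mul hG))

end Feasible

/-! ### Robust stability and performance -/

section Robust

variable {n m p : ℕ}

lemma sigmaMax_mul_le_hinfNorm {ι κ τ : Type} [Fintype ι] [Fintype κ] [Fintype τ] [DecidableEq κ]
    [DecidableEq τ] [DecidableEq ι] {D : TransferMatrix ι κ} {U : TransferMatrix κ τ}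
    (hD : InRHinf D) (hU : InRHinf U) {a b : ℝ} (ha : hinfNorm D ≤ a) (hb : hinfNorm U ≤ b) (ω : ℝ) :
    sigmaMax (freqResponse (D * U) ω) ≤ a * b := by
  rw [freqResponse_mul hD hU]
  exact sigmaMax_mul_le_mul ((sigmaMax_le_hinfNorm hD ω).trans ha)
    ((sigmaMax_le_hinfNorm hU ω).trans hb)

/-- The Youla parameter, for the plant `Ghat + D`, of the controller with Youla parameter `U` for
the plant `Ghat`. -/
lemma exists_perturbed_response {Ghat D : TransferMatrix (Fin p) (Fin m)}
    {U : TransferMatrix (Fin m) (Fin p)} (hD : InRHinf D) (hU : InRHinf U)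
    {ε v : ℝ} (hDε : hinfNorm D ≤ ε) (hUv : hinfNorm U ≤ v) (hc : ε * v < 1) :
    ∃ Q : TransferMatrix (Fin m) (Fin p), InRHinf Q ∧ Q = U + Q * (D * U) ∧
      1 + (Ghat + D) * Q = (1 + Ghat * U) + (1 + (Ghat + D) * Q) * (D * U) ∧
      1 + Q * (Ghat + D) = (1 + U * Ghat) + U * D * (1 + Q * (Ghat + D)) := by
  have hE : InRHinf (1 - D * U) := inRHinf_one.sub (hD.mul hU)
  have hdet : ∀ ζ : ℂ, ‖ζ‖ ≤ 1 → (diskMat (1 - D * U) ζ).det ≠ 0 := fun ζ hζ =>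
    det_diskMat_one_sub_ne_zero (hD.mul hU) hc (sigmaMax_mul_le_hinfNorm hD hU hDε hUv) hζ
  have hunit : IsUnit (1 - D * U).det :=
    isUnit_det_of_diskMat hE (by simp : ‖(0 : ℂ)‖ ≤ 1) (hdet 0 (by simp))
  set Q := U * (1 - D * U)⁻¹ with hQdef
  have hQE : Q * (1 - D * U) = U := nonsing_inv_mul_cancel_right _ _ hunit
  have hQ : Q = U + Q * (D * U) := by
    rwa [Matrix.mul_sub, Matrix.mul_one, sub_eq_iff_eq_add] at hQE
  -- Push-through identity `U (1 - D U)⁻¹ = (1 - U D)⁻¹ U`, needed for `Z`, where the perturbation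
  -- acts from the left.
  have hQ' : Q = U + U * D * Q := by
    have h1 : (1 - U * D) * U = U * (1 - D * U) := by
      simp only [Matrix.mul_sub, Matrix.sub_mul, Matrix.mul_one, Matrix.one_mul, Matrix.mul_assoc]
    have h2 : (1 - U * D) * Q = U := by
      rw [hQdef, ← Matrix.mul_assoc, h1, mul_nonsing_inv_cancel_right _ _ hunit]
    rwa [Matrix.sub_mul, Matrix.one_mul, sub_eq_iff_eq_add] at h2
  refine ⟨Q, hU.mul (hE.inv hdet), hQ, ?_, ?_⟩
  · have h1 : Ghat * Q = Ghat * U + Ghat * (Q * (D * U)) := by rw [← Matrix.mul_add, ← hQ]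
    have h2 : D * Q = D * U + D * (Q * (D * U)) := by rw [← Matrix.mul_add, ← hQ]
    simp only [Matrix.add_mul, Matrix.one_mul, Matrix.mul_assoc]
    rw [h1, h2]
    abel
  · have h1 : Q * Ghat = U * Ghat + U * D * Q * Ghat := by rw [← Matrix.add_mul, ← hQ']
    have h2 : Q * D = U * D + U * D * Q * D := by rw [← Matrix.add_mul, ← hQ']
    simp only [Matrix.mul_add, Matrix.mul_one, ← Matrix.mul_assoc]
    rw [h1, h2]
    abel

variable {A : Matrix (Fin n) (Fin n) ℝ} {B : Matrix (Fin n) (Fin m) ℝ}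
  {C : Matrix (Fin p) (Fin n) ℝ}

lemma diskMat_one_add_mul_zero {G : TransferMatrix (Fin p) (Fin m)}
    {U : TransferMatrix (Fin m) (Fin p)} (hG : InRHinf G) (hU : InRHinf U)
    (h0 : diskMat G 0 = 0) : diskMat (1 + G * U) 0 = 1 := by
  have hz : ‖(0 : ℂ)‖ ≤ 1 := by simp
  rw [diskMat_add inRHinf_one (hG.mul hU) hz, diskMat_mul hG hU hz, h0, diskMat_one,
    Matrix.zero_mul, add_zero]

lemma diskMat_one_add_mul_zero' {G : TransferMatrix (Fin p) (Fin m)}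
    {U : TransferMatrix (Fin m) (Fin p)} (hG : InRHinf G) (hU : InRHinf U)
    (h0 : diskMat G 0 = 0) : diskMat (1 + U * G) 0 = 1 := by
  have hz : ‖(0 : ℂ)‖ ≤ 1 := by simp
  rw [diskMat_add inRHinf_one (hU.mul hG) hz, diskMat_mul hU hG hz, h0, diskMat_one,
    Matrix.mul_zero, add_zero]

/-- `Q = U (1 - D U)⁻¹` is the Youla parameter of `U Y⁻¹` for the true plant, and each true response
is compared with its estimate at every frequency. -/
theorem IsFeasible.robust {G Ghat : TransferMatrix (Fin p) (Fin m)} (hA : SchurStable A)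
    (hG : G = transferMatrix A B C 0) (hGhat : InRHinf Ghat) {ε α γ : ℝ} {Φ : Responses m p}
    (hε : hinfNorm (G - Ghat) < ε) (hΦ : IsFeasible Ghat ε α γ Φ) :
    IsUnit Φ.Y.det ∧ InternallyStabilizes A B C Φ.controller ∧
      lqgJ G Φ.controller ^ 2 ≤ objective Ghat ε α γ Φ ^ 2 := by
  have hGst : InRHinf G := hG ▸ inRHinf_transferMatrix hA
  have hG0 : diskMat G 0 = 0 := hG ▸ diskMat_transferMatrix_zero hA
  have hε0 : 0 < ε := (hinfNorm_nonneg _).trans_lt hε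
  have hU := hΦ.stable_U
  set v := hinfNorm Φ.U with hv
  have hv0 : 0 ≤ v := hinfNorm_nonneg _
  have hvγ : v ≤ γ := hΦ.norm_U_le.trans (min_le_left _ _)
  have hvα : v ≤ α := hΦ.norm_U_le.trans (min_le_right _ _)
  have hεγ : ε * γ < 1 := by rw [mul_comm]; exact (lt_div_iff₀ hε0).1 hΦ.gamma_lt
  have hcγ : ε * v ≤ ε * γ := mul_le_mul_of_nonneg_left hvγ hε0.le
  have hc : ε * v < 1 := hcγ.trans_lt hεγ
  have hD : InRHinf (G - Ghat) := hGst.sub hGhat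
  obtain ⟨Q, hQ, hQU, hY, hZ⟩ :=
    exists_perturbed_response (Ghat := Ghat) hD hU hε.le hv.ge hc
  rw [add_sub_cancel] at hY hZ
  have hΦe := hΦ.eq_youla
  have eY : Φ.Y = 1 + Ghat * Φ.U := congrArg Responses.Y hΦe
  have eW : Φ.W = Φ.Y * Ghat := by rw [eY]; exact congrArg Responses.W hΦe
  have eZ : Φ.Z = 1 + Φ.U * Ghat := congrArg Responses.Z hΦe
  rw [← eY] at hY
  rw [← eZ] at hZ
  set D := G - Ghat with hDdef
  set Yt := 1 + G * Q with hYt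
  have hYtE : Yt * (1 - D * Φ.U) = Φ.Y := by
    rw [Matrix.mul_sub, Matrix.mul_one, sub_eq_iff_eq_add]
    exact hY
  have hQE : Q * (1 - D * Φ.U) = Φ.U := by
    rw [Matrix.mul_sub, Matrix.mul_one, sub_eq_iff_eq_add]
    exact hQU
  have hYtst : InRHinf Yt := inRHinf_one.add (hGst.mul hQ)
  have hz : ‖(0 : ℂ)‖ ≤ 1 := by simp
  -- Invertibility of `Y` goes through the true plant, which vanishes at infinity, so that `Yt` is
  -- `1` there. The estimate may fail to be strictly proper, and `Y` itself need not be `1` at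
  -- infinity.
  have hYtu : IsUnit Yt.det := isUnit_det_of_diskMat hYtst hz (by
    rw [diskMat_one_add_mul_zero hGst hQ hG0, det_one]; exact one_ne_zero)
  have hEu : IsUnit (1 - D * Φ.U).det :=
    isUnit_det_of_diskMat (inRHinf_one.sub (hD.mul hU)) hz
      (det_diskMat_one_sub_ne_zero (hD.mul hU) hc (sigmaMax_mul_le_hinfNorm hD hU hε.le hv.ge) hz)
  have hYu : IsUnit Φ.Y.det := by
    rw [← hYtE, det_mul]
    exact hYtu.mul hEu
  have hK : Φ.controller = Q * Yt⁻¹ := by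
    have h1 : Φ.U * (1 - D * Φ.U)⁻¹ = Q := by
      conv_lhs => lhs; rw [← hQE]
      exact mul_nonsing_inv_cancel_right _ _ hEu
    rw [Responses.controller, ← hYtE, Matrix.mul_inv_rev, ← Matrix.mul_assoc, h1]
  have hQK : Q = Φ.controller * (1 + G * Q) := by
    rw [hK, ← hYt, nonsing_inv_mul_cancel_right _ _ hYtu]
  obtain ⟨hinv, hcl⟩ := closedLoop_eq hQK
  refine ⟨hYu, internallyStabilizes_of_youla hA hQ ?_, ?_⟩
  · rw [← hG]
    have h1 : (1 + G * Q) * (1 - G * Φ.controller) = 1 := mul_eq_one_comm.1 hinv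
    conv_rhs => rw [hQK]
    rw [Matrix.mul_assoc, h1, Matrix.mul_one]
  · rw [lqgJ_sq hGst hQ hcl]
    have hobj := objective_sq hε0.le (hv0.trans hvα) hΦ hεγ
    set Γ := hinfNorm Ghat with hΓ
    have hΓ0 : 0 ≤ Γ := hinfNorm_nonneg _
    have hc0 : 0 ≤ 1 - ε * v := by linarith
    have hDU := sigmaMax_mul_le_hinfNorm hD hU hε.le hv.ge
    have hUD := sigmaMax_mul_le_hinfNorm hU hD hv.ge hε.le
    have bY : ∀ ω, (1 - ε * v) * frob (freqResponse Yt ω) ≤ frob (freqResponse Φ.Y ω) := fun ω => by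
      refine frob_le_of_eq_add_mul (hDU ω) ?_
      rw [← freqResponse_mul hYtst (hD.mul hU),
        ← freqResponse_add hΦ.stable_Y (hYtst.mul (hD.mul hU)), ← hY]
    have bU : ∀ ω, (1 - ε * v) * frob (freqResponse Q ω) ≤ frob (freqResponse Φ.U ω) := fun ω => by
      refine frob_le_of_eq_add_mul (hDU ω) ?_
      rw [← freqResponse_mul hQ (hD.mul hU), ← freqResponse_add hU (hQ.mul (hD.mul hU)), ← hQU]
    have hZst : InRHinf (1 + Q * G) := inRHinf_one.add (hQ.mul hGst)
    have bZ : ∀ ω, (1 - ε * v) * frob (freqResponse (1 + Q * G) ω) ≤ frob (freqResponse Φ.Z ω) :=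
      fun ω => by
        refine frob_le_of_eq_add_mul' (P := freqResponse (Φ.U * D) ω) ?_ ?_
        · rw [mul_comm ε]; exact hUD ω
        · rw [← freqResponse_mul (hU.mul hD) hZst,
            ← freqResponse_add hΦ.stable_Z ((hU.mul hD).mul hZst), ← hZ]
    have hWst : InRHinf (Yt * G) := hYtst.mul hGst
    have eWt : Yt * G = Φ.W + (Yt * D + Yt * (D * Φ.U * Ghat)) := by
      have h1 : Yt * G = Yt * Ghat + Yt * D := by rw [← Matrix.mul_add, hDdef, add_sub_cancel]
      have h2 : Yt * Ghat = Φ.Y * Ghat + Yt * (D * Φ.U * Ghat) := by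
        rw [← Matrix.mul_assoc, ← Matrix.add_mul, ← hY]
      rw [h1, h2, eW]
      abel
    have bW : ∀ ω, (1 - ε * v) ^ 2 * frob (freqResponse (Yt * G) ω) ^ 2 ≤
        1 * frob (freqResponse Φ.W ω) ^ 2 +
          perturbationFactor Γ ε α * frob (freqResponse Φ.Y ω) ^ 2 + 0 := fun ω => by
      have hσG := sigmaMax_le_hinfNorm hGhat ω
      have hσD := (sigmaMax_le_hinfNorm hD ω).trans hε.le
      have hDUG := sigmaMax_mul_le_mul (hDU ω) hσG
      rw [← freqResponse_mul (hD.mul hU) hGhat] at hDUG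
      have hW1 : frob (freqResponse Φ.W ω) ≤ frob (freqResponse Φ.Y ω) * Γ := by
        rw [eW, freqResponse_mul hΦ.stable_Y hGhat]
        exact frob_mul_le_mul hσG
      rw [one_mul, add_zero]
      refine scalar_plant_response (frob_nonneg _) (frob_nonneg _) (frob_nonneg _) hΓ0 hε0.le hv0
        hvα hc hW1 ?_
      have hst := (hD.mul hU).mul hGhat
      have h1 : frob (freqResponse (Yt * G) ω) ≤ frob (freqResponse Φ.W ω) +
          frob (freqResponse Yt ω) * (ε + ε * v * Γ) := by
        rw [eWt, freqResponse_add hΦ.stable_W ((hYtst.mul hD).add (hYtst.mul hst)),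
          freqResponse_add (hYtst.mul hD) (hYtst.mul hst), freqResponse_mul hYtst hD,
          freqResponse_mul hYtst hst, mul_add]
        exact (frob_add_le _ _).trans (add_le_add le_rfl ((frob_add_le _ _).trans
          (add_le_add (frob_mul_le_mul hσD) (frob_mul_le_mul hDUG))))
      have h2 := mul_le_mul_of_nonneg_left h1 hc0
      have h3 := mul_le_mul_of_nonneg_right (bY ω)
        (by positivity : 0 ≤ ε + ε * v * Γ)
      linarith
    have cY := h2Sq_le_of_frob_le hYtst hΦ.stable_Y hc0 bY
    have cU := h2Sq_le_of_frob_le hQ hU hc0 bU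
    have cZ := h2Sq_le_of_frob_le hZst hΦ.stable_Z hc0 bZ
    have cW := h2Sq_le_affine hWst hΦ.stable_Y hΦ.stable_W bW
    -- The pointwise bounds involve the actual norm `v`; the objective only has the larger `γ`.
    have hk : (1 - ε * γ) ^ 2 * objective Ghat ε α γ Φ ^ 2 ≤
        (1 - ε * v) ^ 2 * objective Ghat ε α γ Φ ^ 2 := by
      gcongr
    refine le_of_mul_le_mul_left (a := (1 - ε * v) ^ 2) ?_ (pow_pos (by linarith) 2)
    linarith

end Robust

/-! ### Feasible candidates -/

section Candidates

variable {m p : ℕ} {G Ghat : TransferMatrix (Fin p) (Fin m)} {U : TransferMatrix (Fin m) (Fin p)}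

lemma frob_sq_le_hinfNorm (hG : InRHinf G) (ω : ℝ) :
    frob (freqResponse G ω) ^ 2 ≤ hinfNorm G ^ 2 * m := by
  have h1 := frob_le_sigmaMax (freqResponse G ω)
  rw [Fintype.card_fin] at h1
  have h2 := pow_le_pow_left₀ (frob_nonneg _) (h1.trans (mul_le_mul_of_nonneg_right
    (sigmaMax_le_hinfNorm hG ω) (Real.sqrt_nonneg _))) 2
  rwa [mul_pow, Real.sq_sqrt (Nat.cast_nonneg m)] at h2

lemma frob_mul_le_of_hinfNorm (hG : InRHinf G) (hU : InRHinf U) {ε u : ℝ} (hε : hinfNorm G ≤ ε)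
    (hu : hinfNorm U ≤ u) (ω : ℝ) :
    frob (freqResponse (G * U) ω) ≤ ε * u * √m ∧ frob (freqResponse (U * G) ω) ≤ ε * u * √m := by
  have hσG := (sigmaMax_le_hinfNorm hG ω).trans hε
  have hσU := (sigmaMax_le_hinfNorm hU ω).trans hu
  have hu0 := (hinfNorm_nonneg U).trans hu
  have hG1 : frob (freqResponse G ω) ≤ ε * √m := by
    have h := frob_le_sigmaMax (freqResponse G ω)
    rw [Fintype.card_fin] at h
    exact h.trans (mul_le_mul_of_nonneg_right hσG (Real.sqrt_nonneg _))
  rw [freqResponse_mul hG hU, freqResponse_mul hU hG]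
  have h1 := (frob_mul_le_mul (M := freqResponse G ω) hσU).trans
    (mul_le_mul_of_nonneg_right hG1 hu0)
  have h2 := (frob_mul_le (freqResponse U ω) (freqResponse G ω)).trans
    (mul_le_mul hσU hG1 (frob_nonneg _) hu0)
  constructor <;> linarith

lemma h2Sq_le_of_frob_sub_le {ι κ : Type} [Fintype ι] [Fintype κ] {X Y : TransferMatrix ι κ}
    (hX : InRHinf X) (hY : InRHinf Y) {x c : ℝ} (hx : 0 ≤ x) (hc : 0 ≤ c)
    (h : ∀ ω, frob (freqResponse (Y - X) ω) ≤ x * √c) :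
    h2Sq X ≤ (1 + x) * (h2Sq Y + x * c) := by
  have h1 := h2Sq_le_affine (k := 1) (a := 1 + x) (b := 0) (c := (1 + x) * (x * c)) hX hY hY
    fun ω => by
      have h2 := frob_sub_le (freqResponse Y ω) (freqResponse (Y - X) ω)
      rw [freqResponse_sub hY hX, sub_sub_cancel, ← freqResponse_sub hY hX] at h2
      have h3 := pow_le_pow_left₀ (frob_nonneg _) (h2.trans (add_le_add le_rfl (h ω))) 2
      have h4 := scalar_identity_response (y := frob (freqResponse Y ω)) hx (Real.sq_sqrt hc).le
      linarith
  linarith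

/-- The open-loop candidate has `Y = 1`, `W = Ghat`, `Z = 1` and no prefactor, since `γ = 0`. -/
lemma objective_zero_le (hGhat : InRHinf Ghat) {ε α : ℝ} (hε : 0 < ε) (hα : 0 ≤ α) :
    IsFeasible Ghat ε α 0 (youla Ghat 0) ∧ objective Ghat ε α 0 (youla Ghat 0) ^ 2 ≤
      (1 + perturbationFactor (hinfNorm Ghat) ε α) * p + m + hinfNorm Ghat ^ 2 * m := by
  have hΦ : IsFeasible Ghat ε α 0 (youla Ghat 0) := by
    refine isFeasible_youla hGhat inRHinf_zero le_rfl (by positivity) ?_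
    rw [hinfNorm_zero]
    exact le_min le_rfl hα
  refine ⟨hΦ, ?_⟩
  have h := objective_sq hε.le hα hΦ (by simp)
  rw [mul_zero, sub_zero, one_pow, one_mul] at h
  rw [h]
  have hone : ∀ k : ℕ, h2Sq (1 : TransferMatrix (Fin k) (Fin k)) ≤ k := fun k =>
    h2Sq_le_const inRHinf_one fun ω => by rw [freqResponse_one, frob_one_sq, Fintype.card_fin]
  have hzero : h2Sq (0 : TransferMatrix (Fin m) (Fin p)) ≤ 0 :=
    h2Sq_le_const inRHinf_zero fun ω => by
      have : freqResponse (0 : TransferMatrix (Fin m) (Fin p)) ω = 0 := by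
        simpa using freqResponse_sub (inRHinf_zero (ι := Fin m) (κ := Fin p)) inRHinf_zero ω
      simp [this, frob_sq]
  have hW : h2Sq Ghat ≤ hinfNorm Ghat ^ 2 * m := h2Sq_le_const hGhat (frob_sq_le_hinfNorm hGhat)
  have hh := perturbationFactor_nonneg (hinfNorm_nonneg Ghat) hε.le hα
  have h1 := mul_le_mul_of_nonneg_left (hone p)
    (by linarith : 0 ≤ 1 + perturbationFactor (hinfNorm Ghat) ε α)
  have h2 := hone m
  simp only [youla, Matrix.mul_zero, Matrix.zero_mul, add_zero, Matrix.one_mul]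
  linarith

lemma objective_youla_le (hG : InRHinf G) (hGhat : InRHinf Ghat) (hU : InRHinf U) {ε α u x : ℝ}
    (hε : hinfNorm (G - Ghat) ≤ ε) (hu : u = hinfNorm U) (hx : x = ε * u) (hx1 : x < 1)
    (hε0 : 0 < ε) (hα : u ≤ α) :
    IsFeasible Ghat ε α u (youla Ghat U) ∧
      (1 - x) ^ 2 * objective Ghat ε α u (youla Ghat U) ^ 2 ≤
        (1 + perturbationFactor (hinfNorm Ghat) ε α) * ((1 + x) * (h2Sq (1 + G * U) + x * m)) +
        ((1 + 10 * x) * h2Sq ((1 + G * U) * G) +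
          (2 * ε * hinfNorm G + 2 * ε ^ 2) * h2Sq (1 + G * U) +
          (x / 10 + 2 * x ^ 2) * (hinfNorm Ghat ^ 2 * m)) + h2Sq U +
        (1 + x) * (h2Sq (1 + U * G) + x * m) := by
  have hu0 : 0 ≤ u := hu ▸ hinfNorm_nonneg U
  have hx0 : 0 ≤ x := by rw [hx]; positivity
  have hΦ : IsFeasible Ghat ε α u (youla Ghat U) := by
    refine isFeasible_youla hGhat hU hu0 ?_ ?_
    · rw [lt_div_iff₀ hε0, mul_comm, ← hx]
      exact hx1
    · rw [← hu]
      exact le_min le_rfl hα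
  refine ⟨hΦ, ?_⟩
  rw [hx, objective_sq hε0.le (hu0.trans hα) hΦ (hx ▸ hx1), ← hx]
  have hD : InRHinf (G - Ghat) := hG.sub hGhat
  set D := G - Ghat with hDdef
  have hY : InRHinf (1 + G * U) := inRHinf_one.add (hG.mul hU)
  have hZ : InRHinf (1 + U * G) := inRHinf_one.add (hU.mul hG)
  have hfrob := frob_mul_le_of_hinfNorm hD hU hε hu.ge
  have bY : h2Sq (1 + Ghat * U) ≤ (1 + x) * (h2Sq (1 + G * U) + x * m) := by
    refine h2Sq_le_of_frob_sub_le hΦ.stable_Y hY hx0 (Nat.cast_nonneg m) fun ω => ?_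
    have h1 : 1 + G * U - (1 + Ghat * U) = D * U := by
      rw [add_sub_add_left_eq_sub, ← Matrix.sub_mul]
    rw [youla, h1, hx]
    exact (hfrob ω).1
  have bZ : h2Sq (1 + U * Ghat) ≤ (1 + x) * (h2Sq (1 + U * G) + x * m) := by
    refine h2Sq_le_of_frob_sub_le hΦ.stable_Z hZ hx0 (Nat.cast_nonneg m) fun ω => ?_
    have h1 : 1 + U * G - (1 + U * Ghat) = U * D := by
      rw [add_sub_add_left_eq_sub, ← Matrix.mul_sub]
    rw [youla, h1, hx]
    exact (hfrob ω).2
  have hW : InRHinf ((1 + G * U) * G) := hY.mul hG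
  have hDUG := (hD.mul hU).mul hGhat
  -- The perturbation of `W` splits into a part controlled by `Y` and the part `D U Ghat`, bounded
  -- by `x` times the Frobenius norm of `Ghat`. Only the latter produces `‖Ghat‖² m`.
  have eW : (1 + Ghat * U) * Ghat =
      (1 + G * U) * G - ((1 + G * U) * D + D * U * Ghat) := by
    rw [hDdef]
    simp only [Matrix.add_mul, Matrix.mul_sub, Matrix.sub_mul]
    abel
  have bW : 1 * h2Sq ((1 + Ghat * U) * Ghat) ≤ (1 + 10 * x) * h2Sq ((1 + G * U) * G) +
      (2 * ε * hinfNorm G + 2 * ε ^ 2) * h2Sq (1 + G * U) +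
      (x / 10 + 2 * x ^ 2) * (hinfNorm Ghat ^ 2 * m) := by
    refine h2Sq_le_affine hΦ.stable_W hY hW fun ω => ?_
    have hσD := (sigmaMax_le_hinfNorm hD ω).trans hε
    have h1 := frob_sub_le (freqResponse ((1 + G * U) * G) ω)
      (freqResponse ((1 + G * U) * D + D * U * Ghat) ω)
    rw [← freqResponse_sub hW ((hY.mul hD).add hDUG), ← eW,
      freqResponse_add (hY.mul hD) hDUG, freqResponse_mul hY hD,
      freqResponse_mul (hD.mul hU) hGhat] at h1
    have h2 := (frob_add_le (freqResponse (1 + G * U) ω * freqResponse D ω)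
      (freqResponse (D * U) ω * freqResponse Ghat ω)).trans (add_le_add (frob_mul_le_mul hσD)
        ((frob_mul_le _ _).trans (mul_le_mul_of_nonneg_right
          (sigmaMax_mul_le_hinfNorm hD hU hε hu.ge ω) (frob_nonneg _))))
    rw [← hx] at h2
    have h3 := pow_le_pow_left₀ (frob_nonneg _) (h1.trans (add_le_add le_rfl h2)) 2
    have hwy : frob (freqResponse ((1 + G * U) * G) ω) ≤
        frob (freqResponse (1 + G * U) ω) * hinfNorm G := by
      rw [freqResponse_mul hY hG]
      exact frob_mul_le_mul (sigmaMax_le_hinfNorm hG ω)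
    have h6 := scalar_estimated_response (frob_nonneg _) hε0.le hx0 hwy
      (frob_sq_le_hinfNorm hGhat ω)
    rw [one_mul]
    refine le_trans ?_ h6
    rw [add_assoc]
    exact h3
  have hh := perturbationFactor_nonneg (hinfNorm_nonneg Ghat) hε0.le (hu0.trans hα)
  have h1 := mul_le_mul_of_nonneg_left bY
    (by linarith : 0 ≤ 1 + perturbationFactor (hinfNorm Ghat) ε α)
  simp only [youla]
  linarith

/-- The optimal value of the synthesis problem is close to the cost of any stable response. -/
theorem exists_isFeasible_le (hG : InRHinf G) (hG0 : diskMat G 0 = 0) (hGhat : InRHinf Ghat)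
    (hU : InRHinf U) {ε α u : ℝ} (hε : hinfNorm (G - Ghat) < ε) (hu : u = hinfNorm U)
    (hx : ε * u ≤ 1 / 5) (hα : u ≤ α) :
    ∃ γ Φ, IsFeasible Ghat ε α γ Φ ∧ objective Ghat ε α γ Φ ^ 2 ≤
      (1 + 20 * ε * u + perturbationFactor (hinfNorm Ghat) ε α +
        perturbationFactor (hinfNorm G) ε u) *
      (h2Sq (1 + G * U) + h2Sq ((1 + G * U) * G) + h2Sq U + h2Sq (1 + U * G)) := by
  have hε0 : 0 < ε := (hinfNorm_nonneg _).trans_lt hε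
  have hu0 : 0 ≤ u := hu ▸ hinfNorm_nonneg U
  have hα0 := hu0.trans hα
  have hpy := card_le_h2Sq (inRHinf_one.add (hG.mul hU)) (diskMat_one_add_mul_zero hG hU hG0)
  have hmz := card_le_h2Sq (inRHinf_one.add (hU.mul hG)) (diskMat_one_add_mul_zero' hG hU hG0)
  rw [Fintype.card_fin] at hpy hmz
  have hγΓ : hinfNorm Ghat ≤ hinfNorm G + ε :=
    (hinfNorm_le_add_sub hG hGhat).trans (by linarith)
  have hg : perturbationFactor (hinfNorm G) ε u = 2 * ε * hinfNorm G + ε * u * hinfNorm G ^ 2 +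
      (2 * ε + ε * u * hinfNorm G) ^ 2 := by
    rw [perturbationFactor]
    ring
  obtain ⟨hf1, h1⟩ := objective_youla_le hG hGhat hU hε.le hu rfl (by linarith) hε0 hα
  obtain ⟨hf2, h2⟩ := objective_zero_le hGhat hε0 hα0
  rw [show 20 * ε * u = 20 * (ε * u) by ring]
  rcases two_candidates (by positivity) hx hε0.le (hinfNorm_nonneg G) (hinfNorm_nonneg Ghat) hγΓ
    (perturbationFactor_nonneg (hinfNorm_nonneg Ghat) hε0.le hα0) hg (Nat.cast_nonneg p)
    (Nat.cast_nonneg m) hpy hmz (h2Sq_nonneg ((1 + G * U) * G)) (h2Sq_nonneg U) with h | h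
  · exact ⟨_, _, hf2, h2.trans h⟩
  · exact ⟨_, _, hf1, le_of_mul_le_mul_left (h1.trans h) (pow_pos (by linarith) 2)⟩

end Candidates

/-! ### The suboptimality guarantee -/

section Guarantee

variable {n m p : ℕ} {A : Matrix (Fin n) (Fin n) ℝ} {B : Matrix (Fin n) (Fin m) ℝ}
  {C : Matrix (Fin p) (Fin n) ℝ} {G Ghat : TransferMatrix (Fin p) (Fin m)}
  {K : TransferMatrix (Fin m) (Fin p)} {u ε α : ℝ}

lemma IsAdmissible.bounds (hu : 0 ≤ u) (h : IsAdmissible G Ghat u ε α) :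
    0 < ε ∧ ε * u ≤ 1 / 5 ∧ u ≤ α := by
  have hε : 0 < ε := (hinfNorm_nonneg _).trans_lt h.error_lt
  have hx : ε * u ≤ 1 / 5 := by linarith [h.small]
  refine ⟨hε, hx, le_trans ?_ h.alpha_ge⟩
  have hx0 : 0 ≤ ε * u := by positivity
  rw [le_div_iff₀ (by linarith)]
  have h1 : 1 ≤ √2 := Real.one_le_sqrt.2 (by norm_num)
  nlinarith [mul_nonneg hu hx0, mul_nonneg hu (sub_nonneg.2 h1)]

theorem IsNearOptimal.guarantee (hA : SchurStable A) (hG : G = transferMatrix A B C 0)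
    (hK : InternallyStabilizes A B C K) (hu : u = hinfNorm (closedLoop G K).U)
    {δ γ : ℝ} {Φ : Responses m p} (hδ : 0 ≤ δ) (hadm : IsAdmissible G Ghat u ε α)
    (hΦ : IsNearOptimal δ Ghat ε α γ Φ) :
    IsUnit Φ.Y.det ∧ InternallyStabilizes A B C Φ.controller ∧
      1 + relativeError G Φ.controller K ≤
        (1 + δ) ^ 2 * (1 + 20 * ε * u + perturbationFactor (hinfNorm Ghat) ε α +
          perturbationFactor (hinfNorm G) ε u) := by
  have hGst : InRHinf G := hG ▸ inRHinf_transferMatrix hA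
  have hG0 : diskMat G 0 = 0 := hG ▸ diskMat_transferMatrix_zero hA
  obtain ⟨q, κ, hκK, hκ⟩ := hK
  obtain ⟨U, hU, hUK⟩ := exists_stable_response κ hκ
  rw [hκK, ← hG] at hUK
  obtain ⟨-, hcl⟩ := closedLoop_eq hUK
  have hu' : u = hinfNorm U := by rw [hu, hcl]
  have hu0 : 0 ≤ u := hu' ▸ hinfNorm_nonneg U
  obtain ⟨hε, hx, hα⟩ := hadm.bounds hu0
  obtain ⟨γ', Φ', hΦ', hobj⟩ :=
    exists_isFeasible_le hGst hG0 hadm.stable hU hadm.error_lt hu' hx hα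
  rw [← lqgJ_sq hGst hU hcl] at hobj
  obtain ⟨h1, h2, h3⟩ := hΦ.1.robust hA hG hadm.stable hadm.error_lt
  refine ⟨h1, h2, ?_⟩
  set R := 1 + 20 * ε * u + perturbationFactor (hinfNorm Ghat) ε α +
    perturbationFactor (hinfNorm G) ε u with hR
  have hR1 : 1 ≤ R := by
    have e1 := perturbationFactor_nonneg (hinfNorm_nonneg Ghat) hε.le (hu0.trans hα)
    have e2 := perturbationFactor_nonneg (hinfNorm_nonneg G) hε.le hu0
    have e3 : 0 ≤ 20 * ε * u := by positivity
    linarith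
  have hγ : ε * γ < 1 := by rw [mul_comm]; exact (lt_div_iff₀ hε).1 hΦ.1.gamma_lt
  have h4 : lqgJ G Φ.controller ^ 2 ≤ (1 + δ) ^ 2 * R * lqgJ G K ^ 2 := by
    have h5 := pow_le_pow_left₀ (objective_nonneg hγ) (hΦ.2 γ' Φ' hΦ') 2
    rw [mul_pow] at h5
    have h6 := mul_le_mul_of_nonneg_left hobj (sq_nonneg (1 + δ))
    linarith
  -- If the reference cost is `0`, the quotient is `0` by the division convention and the claim is
  -- `1 ≤ (1 + δ)² R`.
  rcases (sq_nonneg (lqgJ G K)).eq_or_lt with h0 | h0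
  · rw [relativeError, ← h0, div_zero, add_zero]
    nlinarith
  · rw [relativeError, sub_div, div_self h0.ne', add_sub_cancel, div_le_iff₀ h0]
    exact h4

lemma perturbationFactor_le_mul {Γ Γ' a a' E : ℝ} (hΓ : 0 ≤ Γ) (hΓ' : Γ ≤ Γ') (ha : 0 ≤ a)
    (ha' : a ≤ a') (hε : 0 ≤ ε) (hεE : ε ≤ E) :
    perturbationFactor Γ ε a ≤ (Γ' * (2 + a' * Γ') + E * (2 + a' * Γ') ^ 2) * ε := by
  have h1 : perturbationFactor Γ ε a = (Γ * (2 + a * Γ) + ε * (2 + a * Γ) ^ 2) * ε := by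
    rw [perturbationFactor]
    ring
  have hΓ0 := hΓ.trans hΓ'
  have ha0 := ha.trans ha'
  rw [h1]
  gcongr
  exact hε.trans hεE

end Guarantee

end LQG

end

/-! ### Assembly of the three claims -/

theorem mainTheorem1 {n m p : ℕ} (A : Matrix (Fin n) (Fin n) ℝ) (B : Matrix (Fin n) (Fin m) ℝ)
    (C : Matrix (Fin p) (Fin n) ℝ) (hA : LQG.SchurStable A)
    (Gs : LQG.TransferMatrix (Fin p) (Fin m)) (hGs : Gs = LQG.transferMatrix A B C 0)
    (Ks : LQG.TransferMatrix (Fin m) (Fin p)) (hKs : LQG.IsOptimalLQG A B C Ks)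
    (u : ℝ) (hu : u = LQG.hinfNorm (LQG.closedLoop Gs Ks).U) :
    -- the guarantee for optimal solutions
    (∀ (ε α : ℝ) (Ghat : LQG.TransferMatrix (Fin p) (Fin m)) (γ : ℝ) (Φ : LQG.Responses m p),
      LQG.IsAdmissible Gs Ghat u ε α → LQG.IsOptimalSolution Ghat ε α γ Φ →
        IsUnit Φ.Y.det ∧
        LQG.InternallyStabilizes A B C Φ.controller ∧
        LQG.relativeError Gs Φ.controller Ks ≤
          20 * ε * u + LQG.perturbationFactor (LQG.hinfNorm Ghat) ε α
            + LQG.perturbationFactor (LQG.hinfNorm Gs) ε u) ∧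
    -- the relative error is `O(ε)`, uniformly over bounded `ε` and `α`
    (∀ εmax αmax : ℝ, ∃ M : ℝ,
      ∀ (ε α : ℝ) (Ghat : LQG.TransferMatrix (Fin p) (Fin m)) (γ : ℝ) (Φ : LQG.Responses m p),
        ε ≤ εmax → α ≤ αmax →
        LQG.IsAdmissible Gs Ghat u ε α → LQG.IsOptimalSolution Ghat ε α γ Φ →
          LQG.relativeError Gs Φ.controller Ks ≤ M * ε) ∧
    -- the guarantee for solutions that are optimal up to a factor `1 + δ`
    (∀ (δ ε α : ℝ) (Ghat : LQG.TransferMatrix (Fin p) (Fin m)) (γ : ℝ) (Φ : LQG.Responses m p),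
      0 ≤ δ →
      LQG.IsAdmissible Gs Ghat u ε α → LQG.IsNearOptimal δ Ghat ε α γ Φ →
        IsUnit Φ.Y.det ∧
        LQG.InternallyStabilizes A B C Φ.controller ∧
        1 + LQG.relativeError Gs Φ.controller Ks ≤
          (1 + δ) ^ 2 * (1 + 20 * ε * u + LQG.perturbationFactor (LQG.hinfNorm Ghat) ε α
            + LQG.perturbationFactor (LQG.hinfNorm Gs) ε u)) := by
  have hK : LQG.InternallyStabilizes A B C Ks := by
    obtain ⟨q, κ, c, hκ, hst, -⟩ := hKs
    exact ⟨q, κ, hκ, hst⟩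
  have hu0 : 0 ≤ u := hu ▸ LQG.hinfNorm_nonneg _
  have main : ∀ (ε α : ℝ) (Ghat : LQG.TransferMatrix (Fin p) (Fin m)) (γ : ℝ)
      (Φ : LQG.Responses m p), LQG.IsAdmissible Gs Ghat u ε α →
      LQG.IsOptimalSolution Ghat ε α γ Φ →
        IsUnit Φ.Y.det ∧ LQG.InternallyStabilizes A B C Φ.controller ∧
        LQG.relativeError Gs Φ.controller Ks ≤
          20 * ε * u + LQG.perturbationFactor (LQG.hinfNorm Ghat) ε α
            + LQG.perturbationFactor (LQG.hinfNorm Gs) ε u := by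
    intro ε α Ghat γ Φ hadm hΦ
    obtain ⟨h1, h2, h3⟩ := LQG.IsNearOptimal.guarantee hA hGs hK hu le_rfl hadm
      ⟨hΦ.1, fun γ' Φ' h => by rw [add_zero, one_mul]; exact hΦ.2 γ' Φ' h⟩
    exact ⟨h1, h2, by linarith⟩
  refine ⟨main, fun E a => ?_, fun δ ε α Ghat γ Φ hδ hadm hΦ =>
    LQG.IsNearOptimal.guarantee hA hGs hK hu hδ hadm hΦ⟩
  set Γ := LQG.hinfNorm Gs with hΓ
  -- The bounds of `h / ε` and `g / ε` for `ε ≤ E`, `α ≤ a`; the unknown `‖Ghat‖` is replaced by `Γ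
  -- + E`.
  refine ⟨20 * u + ((Γ + E) * (2 + a * (Γ + E)) + E * (2 + a * (Γ + E)) ^ 2)
    + (Γ * (2 + u * Γ) + E * (2 + u * Γ) ^ 2), fun ε α Ghat γ Φ hεE hαa hadm hΦ => ?_⟩
  obtain ⟨hε, -, hα⟩ := hadm.bounds hu0
  have hGhat : LQG.hinfNorm Ghat ≤ Γ + E := by
    have h := LQG.hinfNorm_le_add_sub (hGs ▸ LQG.inRHinf_transferMatrix hA) hadm.stable
    linarith [hadm.error_lt]
  have h1 := (main ε α Ghat γ Φ hadm hΦ).2.2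
  have h2 := LQG.perturbationFactor_le_mul (LQG.hinfNorm_nonneg Ghat) hGhat (hu0.trans hα) hαa
    hε.le hεE
  have h3 := LQG.perturbationFactor_le_mul (LQG.hinfNorm_nonneg Gs) le_rfl hu0 le_rfl hε.le hεE
  linarith
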